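/- Let ${\bf k}$ be a field of characteristic zero. A (nonunital) operad $\mathcal S$ is a sequence $\mathcal S(n)$, $n\ge 1$, of $\mathbb Z$-graded ${\bf k}$-vector spaces with degree-preserving left actions of the symmetric groups $\Sigma_n$ and degree zero bilinear operations $\circ_i:\mathcal S(m)\otimes\mathcal S(n)\to\mathcal S(m+n-1)$, $1\le i\le n$ (where $f\circ_i g$ plugs $f$ into the $i$-th input of $g$), that are associative, i.e. for $f\in\mathcal S(a)$, $g\in\mathcal S(b)$, $h\in\mathcal S(c)$ (homogeneous in the first and third case) $$f\circ_i(g\circ_j h)=\begin{cases}(-1)^{|f||g|}\,g\circ_{j+a-1}(f\circ_i h), & 1\le i\le j-1,\\ (f\circ_{i-j+1}g)\circ_j h, & j\le i\le b+j-1,\\ (-1)^{|f||g|}\,g\circ_j(f\circ_{i-b+1}h), & i\ge j+b,\end{cases}$$ and equivariant, i.e. $(\sigma f)\circ_{\tau(i)}(\tau g)=(\sigma\circ_i\tau)(f\circ_i g)$, where $\sigma\circ_i\tau\in\Sigma_{m+n-1}$ is obtained by inserting $\sigma$ at the $i$-th place of $\tau$. A collection is a sequence $E(n)$, $n\ge 2$,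 of graded vector spaces with degree-preserving $\Sigma_n$-actions; $\mathcal F(E)$ denotes the free operad on $E$, and $\mathcal F^{\ge 2}(E)\subset\mathcal F(E)$ the part spanned by the words with at least two letters from $E$. A differential $d$ on an operad is a family of equivariant linear maps of degree $-1$ with $d^2=0$ and $d(f\circ_i g)=df\circ_i g+(-1)^{|f|}f\circ_i dg$; then $\mathcal H(\mathcal S,d)$ denotes the homology operad. If a collection decomposes into subcollections as $Z=Z^0\oplus Z^1\oplus\cdots$, let $\mathcal F(Z)^k$ be the subspace of $\mathcal F(Z)$ spanned by the words in letters from $Z^{k_1},Z^{k_2},\dots$ with $k_1+k_2+\cdots=k$ (TJ-degree $k$). If $d$ is a differential on $\mathcal F(Z)$ that lowers the TJ-degree by one, $\mathcal H^k(\mathcal F(Z),d)$ denotes the part of $\mathcal H(\mathcal F(Z),d)$ represented by cycles in $\mathcal F(Z)^k$. **Theorem.** Let $\mathcal H$ be an operad with $\mathcal H(1)=0$. Then there exist a collection $Z=Z^0\oplus Z^1\oplus\cdots$, a differential $d$ on $\mathcal F(Z)$ with $d(Z^0)=0$ and $d(Z^k)\subset\mathcal F(Z)^{k-1}$ for all $k\ge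 1$, and a homomorphism $\rho:(\mathcal F(Z),d)\to(\mathcal H,0)$ of differential operads such that 1. $d$ is minimal: $d(Z)\subset\mathcal F^{\ge 2}(Z)$; 2. $\rho$ vanishes on $Z^k$ for all $k\ge 1$, and $\rho$ induces an isomorphism $\mathcal H^0(\mathcal F(Z),d)\cong\mathcal H$; 3. $\mathcal H^k(\mathcal F(Z),d)=0$ for all $k\ge 1$. -/

import Mathlib

universe u v w

open Equiv

/-! ### Graded modules -/

/-- A family of submodules admitting compatible projections, and spanning, is a direct sum
decomposition. -/
theorem isInternal_of_projections {k : Type u} [Field k] {M : Type v} [AddCommGroup M]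
    [Module k M] (A : ℤ → Submodule k M) (htop : ⨆ j, A j = ⊤) (π : ℤ → M →ₗ[k] M)
    (hsame : ∀ j, ∀ x ∈ A j, π j x = x) (hne : ∀ i j, i ≠ j → ∀ x ∈ A i, π j x = 0) :
    DirectSum.IsInternal A := by
  apply DirectSum.isInternal_submodule_of_iSupIndep_of_iSup_eq_top _ htop
  intro j
  rw [Submodule.disjoint_def]
  intro x hx hx'
  have : (⨆ i, ⨆ (_ : i ≠ j), A i) ≤ LinearMap.ker (π j) := by
    refine iSup_le fun i => iSup_le fun hi => fun y hy => ?_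
    exact hne i j hi y hy
  rw [← hsame j x hx]
  exact this hx'

/-- The sign `(-1)^e` as a scalar. -/
def koszulSign (k : Type u) [Field k] (e : ℤ) : k := ((e.negOnePow : ℤ) : k)

/-! ### Sequences of graded representations of the symmetric groups -/

/-- A sequence, indexed by the arity `n`, of `ℤ`-graded `k`-vector spaces `V n = ⨁ j, deg n j`
(the grading by `j` is the inner grading), each with a degree-preserving linear left action of the
symmetric group on `n` letters. -/
structure SymSeq (k : Type u) [Field k] where
  V : ℕ → Type v
  [addCommGroup : ∀ n, AddCommGroup (V n)]
  [module : ∀ n, Module k (V n)]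
  act : ∀ n, Perm (Fin n) →* Module.End k (V n)
  deg : ∀ n, ℤ → Submodule k (V n)
  isInternal : ∀ n, DirectSum.IsInternal (deg n)
  act_mem : ∀ {n} (σ : Perm (Fin n)) {j : ℤ} {x : V n}, x ∈ deg n j → act n σ x ∈ deg n j

attribute [instance] SymSeq.addCommGroup SymSeq.module

namespace SymSeq

variable {k : Type u} [Field k] (S : SymSeq.{u, v} k)

/-- Projection onto the homogeneous component of degree `j`. -/
noncomputable def proj (n : ℕ) (j : ℤ) : S.V n →ₗ[k] S.V n :=
  (S.deg n j).subtype ∘ₗ DirectSum.component k ℤ (fun i => S.deg n i) j ∘ₗ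
    (LinearEquiv.ofBijective (DirectSum.coeLinearMap (S.deg n)) (S.isInternal n)).symm.toLinearMap

theorem proj_mem (n : ℕ) (j : ℤ) (x : S.V n) : S.proj n j x ∈ S.deg n j :=
  Submodule.coe_mem _

theorem proj_of_mem {n : ℕ} {i : ℤ} (j : ℤ) {x : S.V n} (hx : x ∈ S.deg n i) :
    S.proj n j x = if i = j then x else 0 := by
  have : (LinearEquiv.ofBijective (DirectSum.coeLinearMap (S.deg n)) (S.isInternal n)).symm x
      = DirectSum.lof k ℤ (fun i => S.deg n i) i ⟨x, hx⟩ := by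
    rw [LinearEquiv.symm_apply_eq]
    exact (DirectSum.coeLinearMap_lof (S.deg n) i ⟨x, hx⟩).symm
  simp only [proj, LinearMap.comp_apply, LinearEquiv.coe_coe, this]
  by_cases h : i = j
  · subst h
    simp [DirectSum.component.lof_self]
  · rw [DirectSum.component.of]
    simp [h]

theorem iSup_deg (n : ℕ) : ⨆ j, S.deg n j = ⊤ := (S.isInternal n).submodule_iSup_eq_top

/-- Every element lies in any submodule containing all its homogeneous components. -/
theorem mem_of_proj_mem {n : ℕ} (W : Submodule k (S.V n)) (x : S.V n)
    (h : ∀ j, S.proj n j x ∈ W) : x ∈ W := by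
  classical
  set e := LinearEquiv.ofBijective (DirectSum.coeLinearMap (S.deg n)) (S.isInternal n) with he
  have hx : DirectSum.coeLinearMap (S.deg n) (e.symm x) = x := e.apply_symm_apply x
  have h' : ∀ j, ((e.symm x) j : S.V n) ∈ W := h
  rw [← hx, DirectSum.coeLinearMap_eq_dfinsuppSum]
  exact Submodule.sum_mem _ fun j _ => h' j

end SymSeq

/-- A collection: arities `n ≥ 2` only. -/
structure Collection (k : Type u) [Field k] extends SymSeq.{u, v} k where
  subsingleton_of_lt_two : ∀ n, n < 2 → Subsingleton (V n)

/-! ### Operads -/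

/-- The inputs of the composite of an operation with `m` inputs, plugged into the `i`-th input of
an operation with `n` inputs. -/
def inputPos {m n p : ℕ} (h : p + 1 = m + n) (i : Fin n) :
    Fin m ⊕ {b : Fin n // b ≠ i} → Fin p
  | .inl a => ⟨i + a, by omega⟩
  | .inr b => if hb : b.1 < i then ⟨b.1, by omega⟩ else
      ⟨b.1 + m - 1, by have := b.2; have : b.1.1 ≠ i.1 := fun e => this (Fin.ext e); omega⟩

theorem inputPos_bijective {m n p : ℕ} (h : p + 1 = m + n) (i : Fin n) :
    Function.Bijective (inputPos h i) := by
  rw [Fintype.bijective_iff_injective_and_card]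
  constructor
  · rintro (a | ⟨b, hb⟩) (a' | ⟨b', hb'⟩) hab
    · simp only [inputPos, Fin.mk.injEq] at hab
      congr 1
      ext
      omega
    · exfalso
      have : b'.1 ≠ i.1 := fun e => hb' (Fin.ext e)
      simp only [inputPos] at hab
      split_ifs at hab with h1 <;> simp only [Fin.mk.injEq] at hab <;>
        simp only [Fin.lt_def] at h1 <;> omega
    · exfalso
      have : b.1 ≠ i.1 := fun e => hb (Fin.ext e)
      simp only [inputPos] at hab
      split_ifs at hab with h1 <;> simp only [Fin.mk.injEq] at hab <;>
        simp only [Fin.lt_def] at h1 <;> omega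
    · have : b.1 ≠ i.1 := fun e => hb (Fin.ext e)
      have : b'.1 ≠ i.1 := fun e => hb' (Fin.ext e)
      simp only [inputPos] at hab
      congr 2
      ext
      split_ifs at hab with h1 h2 h2 <;> simp only [Fin.mk.injEq] at hab <;>
        simp only [Fin.lt_def] at h1 h2 <;> omega
  · have := i.2
    simp only [Fintype.card_sum, Fintype.card_fin, Fintype.card_subtype_compl,
      Fintype.card_unique, ne_eq]
    omega

/-- `inputPos` as a bijection. -/
noncomputable def inputEquiv {m n p : ℕ} (h : p + 1 = m + n) (i : Fin n) :
    Fin m ⊕ {b : Fin n // b ≠ i} ≃ Fin p :=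
  Equiv.ofBijective _ (inputPos_bijective h i)

/-- The permutation obtained by inserting `σ` into `τ`: it sends the inputs of the composite at
the place `j` to the inputs of the composite at the place `τ j`, by `σ` on the inputs of the
inserted operation, and by `τ` on the other ones. -/
noncomputable def insertPerm {m n p : ℕ} (h : p + 1 = m + n) (σ : Perm (Fin m))
    (τ : Perm (Fin n)) (j : Fin n) : Perm (Fin p) :=
  (inputEquiv h j).symm.trans
    ((Equiv.sumCongr σ (τ.subtypeEquiv fun b => not_congr (τ.apply_eq_iff_eq (x := b) (y := j)).symm)).trans
      (inputEquiv h (τ j)))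

/-- A (nonunital, graded, symmetric) operad, given by partial compositions. Arities are `n ≥ 1`
(the arity `0` component is zero). The element `comp h i f g`, also written `f ∘ᵢ g`, is the
composite in which the output of `f`, of arity `m`, is plugged into the `i`-th input of `g`, of
arity `n`; its arity is `p = m + n - 1`. Inputs are numbered from `0`. -/
structure Operad (k : Type u) [Field k] extends SymSeq.{u, v} k where
  subsingleton_zero : Subsingleton (V 0)
  comp : ∀ {m n p : ℕ}, p + 1 = m + n → Fin n → (V m →ₗ[k] V n →ₗ[k] V p)
  comp_mem : ∀ {m n p : ℕ} (h : p + 1 = m + n) (i : Fin n) {s t : ℤ} {f : V m} {g : V n},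
    f ∈ deg m s → g ∈ deg n t → comp h i f g ∈ deg p (s + t)
  /-- Associativity, `f` being plugged into one of the inputs of `g`. -/
  comp_seq : ∀ {a b c q r p : ℕ} (h₁ : q + 1 = b + c) (h₂ : p + 1 = a + q) (h₃ : r + 1 = a + b)
    (h₄ : p + 1 = r + c) (i : Fin b) (j : Fin c) (f : V a) (g : V b) (x : V c),
    comp h₂ ⟨j + i, by omega⟩ f (comp h₁ j g x) = comp h₄ j (comp h₃ i f g) x
  /-- Associativity, `f` and `g` being plugged into two inputs `i < j` of `x`. (Read from right
  to left, with `f` and `g` exchanged, this is also the case `i > j`.) -/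
  comp_par : ∀ {a b c q r p : ℕ} (h₁ : q + 1 = b + c) (h₂ : p + 1 = a + q) (h₃ : r + 1 = a + c)
    (h₄ : p + 1 = b + r) (i j : Fin c) (hij : i < j) {s t : ℤ} {f : V a} {g : V b} (x : V c),
    f ∈ deg a s → g ∈ deg b t →
    comp h₂ ⟨i, by omega⟩ f (comp h₁ j g x) =
      koszulSign k (s * t) • comp h₄ ⟨j + a - 1, by omega⟩ g (comp h₃ i f x)
  /-- Equivariance. -/
  comp_act : ∀ {m n p : ℕ} (h : p + 1 = m + n) (j : Fin n) (σ : Perm (Fin m))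
    (τ : Perm (Fin n)) (f : V m) (g : V n),
    comp h (τ j) (act m σ f) (act n τ g) = act p (insertPerm h σ τ j) (comp h j f g)

namespace Operad

variable {k : Type u} [Field k]

/-- A homomorphism of operads: degree zero equivariant linear maps that preserve the partial
compositions. -/
structure Hom (S : Operad.{u, v} k) (T : Operad.{u, w} k) where
  map : ∀ n, S.V n →ₗ[k] T.V n
  map_mem : ∀ {n : ℕ} {j : ℤ} {x : S.V n}, x ∈ S.deg n j → map n x ∈ T.deg n j
  map_act : ∀ {n : ℕ} (σ : Perm (Fin n)) (x : S.V n), map n (S.act n σ x) = T.act n σ (map n x)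
  map_comp : ∀ {m n p : ℕ} (h : p + 1 = m + n) (i : Fin n) (f : S.V m) (g : S.V n),
    map p (S.comp h i f g) = T.comp h i (map m f) (map n g)

/-- A degree `e` derivation of an operad. -/
structure Derivation (S : Operad.{u, v} k) (e : ℤ) where
  map : ∀ n, S.V n →ₗ[k] S.V n
  map_mem : ∀ {n : ℕ} {j : ℤ} {x : S.V n}, x ∈ S.deg n j → map n x ∈ S.deg n (j + e)
  map_act : ∀ {n : ℕ} (σ : Perm (Fin n)) (x : S.V n), map n (S.act n σ x) = S.act n σ (map n x)
  leibniz : ∀ {m n p : ℕ} (h : p + 1 = m + n) (i : Fin n) {s : ℤ} {f : S.V m} (g : S.V n),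
    f ∈ S.deg m s →
    map p (S.comp h i f g) =
      S.comp h i (map m f) g + koszulSign k (e * s) • S.comp h i f (map n g)

/-- A differential on an operad: a degree `-1` derivation of square zero. -/
structure Differential (S : Operad.{u, v} k) extends Derivation S (-1) where
  map_map : ∀ (n : ℕ) (x : S.V n), map n (map n x) = 0

/-- The trivial differential. -/
def zeroDifferential (S : Operad.{u, v} k) : Differential S where
  map _ := 0
  map_mem _ := Submodule.zero_mem _
  map_act _ _ := by simp
  leibniz _ _ _ _ _ _ := by simp
  map_map _ _ := rfl

/-- `φ` is a homomorphism of differential operads `(S, d) → (T, d')`. -/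
def Hom.Commutes {S : Operad.{u, v} k} {T : Operad.{u, w} k} (φ : Hom S T) (d : Differential S)
    (d' : Differential T) : Prop :=
  ∀ (n : ℕ) (x : S.V n), φ.map n (d.map n x) = d'.map n (φ.map n x)

end Operad

/-! ### The free operad on a collection -/

/-- Formal operadic words in homogeneous elements of a collection. -/
inductive Word {k : Type u} [Field k] (E : Collection.{u, v} k) : ℕ → Type v
  | gen {n : ℕ} (j : ℤ) (z : E.deg n j) : Word E n
  | act {n : ℕ} (σ : Perm (Fin n)) (t : Word E n) : Word E n
  | comp {m n p : ℕ} (h : p + 1 = m + n) (i : Fin n) (s : Word E m) (t : Word E n) : Word E p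

namespace Word

variable {k : Type u} [Field k] {E : Collection.{u, v} k}

/-- Inner degree of a word: the sum of the degrees of its letters. -/
def deg : ∀ {n : ℕ}, Word E n → ℤ
  | _, gen j _ => j
  | _, act _ t => t.deg
  | _, comp _ _ s t => s.deg + t.deg

/-- Length of a word: its number of letters. -/
def length : ∀ {n : ℕ}, Word E n → ℕ
  | _, gen _ _ => 1
  | _, act _ t => t.length
  | _, comp _ _ s t => s.length + t.length

/-- The action of a permutation on formal linear combinations of words. -/
noncomputable def actLin {n : ℕ} (σ : Perm (Fin n)) : (Word E n →₀ k) →ₗ[k] (Word E n →₀ k) :=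
  Finsupp.lmapDomain k k (act σ)

/-- The bilinear extension of the composition of words. -/
noncomputable def compLin {m n p : ℕ} (h : p + 1 = m + n) (i : Fin n) :
    (Word E m →₀ k) →ₗ[k] (Word E n →₀ k) →ₗ[k] (Word E p →₀ k) :=
  Finsupp.linearCombination k fun s => Finsupp.lmapDomain k k (comp h i s)

/-- A word as a formal linear combination. -/
noncomputable abbrev single {n : ℕ} (t : Word E n) : Word E n →₀ k := Finsupp.single t 1

/-- The linear combinations of words that vanish in the free operad: the smallest family of
subspaces, closed under the symmetric group actions and under composition with words, that
contains the relations between the letters and the operad axioms. -/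
inductive Rel : ∀ {n : ℕ}, (Word E n →₀ k) → Prop
  | zero {n : ℕ} : Rel (0 : Word E n →₀ k)
  | add {n : ℕ} {x y : Word E n →₀ k} : Rel x → Rel y → Rel (x + y)
  | smul {n : ℕ} (c : k) {x : Word E n →₀ k} : Rel x → Rel (c • x)
  | act {n : ℕ} (σ : Perm (Fin n)) {x : Word E n →₀ k} : Rel x → Rel (actLin σ x)
  | comp_left {m n p : ℕ} (h : p + 1 = m + n) (i : Fin n) {x : Word E m →₀ k} (t : Word E n) :
      Rel x → Rel (compLin h i x (single t))
  | comp_right {m n p : ℕ} (h : p + 1 = m + n) (i : Fin n) (s : Word E m) {y : Word E n →₀ k} :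
      Rel y → Rel (compLin h i (single s) y)
  | gen_add {n : ℕ} (j : ℤ) (z z' : E.deg n j) :
      Rel (single (gen j (z + z')) - single (gen j z) - single (gen j z'))
  | gen_smul {n : ℕ} (j : ℤ) (c : k) (z : E.deg n j) :
      Rel (single (gen j (c • z)) - c • single (gen j z))
  | gen_act {n : ℕ} (j : ℤ) (σ : Perm (Fin n)) (z : E.deg n j) :
      Rel (single (Word.act σ (gen j z)) - single (gen j ⟨E.act n σ z, E.act_mem σ z.2⟩))
  | act_one {n : ℕ} (t : Word E n) : Rel (single (Word.act 1 t) - single t)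
  | act_mul {n : ℕ} (σ τ : Perm (Fin n)) (t : Word E n) :
      Rel (single (Word.act (σ * τ) t) - single (Word.act σ (Word.act τ t)))
  | comp_seq {a b c q r p : ℕ} (h₁ : q + 1 = b + c) (h₂ : p + 1 = a + q) (h₃ : r + 1 = a + b)
      (h₄ : p + 1 = r + c) (i : Fin b) (j : Fin c) (s : Word E a) (t : Word E b) (x : Word E c) :
      Rel (single (comp h₂ ⟨j + i, by omega⟩ s (comp h₁ j t x)) -
        single (comp h₄ j (comp h₃ i s t) x))
  | comp_par {a b c q r p : ℕ} (h₁ : q + 1 = b + c) (h₂ : p + 1 = a + q) (h₃ : r + 1 = a + c)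
      (h₄ : p + 1 = b + r) (i j : Fin c) (hij : i < j) (s : Word E a) (t : Word E b)
      (x : Word E c) :
      Rel (single (comp h₂ ⟨i, by omega⟩ s (comp h₁ j t x)) -
        koszulSign k (s.deg * t.deg) • single (comp h₄ ⟨j + a - 1, by omega⟩ t (comp h₃ i s x)))
  | comp_act {m n p : ℕ} (h : p + 1 = m + n) (j : Fin n) (σ : Perm (Fin m)) (τ : Perm (Fin n))
      (s : Word E m) (t : Word E n) :
      Rel (single (comp h (τ j) (Word.act σ s) (Word.act τ t)) -
        single (Word.act (insertPerm h σ τ j) (comp h j s t)))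

variable (E) in
/-- The relations of arity `n`, as a subspace. -/
def relSubmodule (n : ℕ) : Submodule k (Word E n →₀ k) where
  carrier := {x | Rel x}
  zero_mem' := Rel.zero
  add_mem' := Rel.add
  smul_mem' c _ := Rel.smul c

@[simp] theorem actLin_single {n : ℕ} (σ : Perm (Fin n)) (t : Word E n) :
    actLin σ (single t) = single (act σ t) := by
  simp [actLin]

@[simp] theorem compLin_single {m n p : ℕ} (h : p + 1 = m + n) (i : Fin n) (s : Word E m)
    (t : Word E n) : compLin h i (single s) (single t) = single (comp h i s t) := by
  simp [compLin]

/-- Two linear combinations agree if a linear identity holds on words. -/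
theorem linear_induction {n : ℕ} {P : (Word E n →₀ k) → Prop} (x : Word E n →₀ k) (h0 : P 0)
    (hadd : ∀ x y, P x → P y → P (x + y)) (hsmul : ∀ (c : k) x, P x → P (c • x))
    (hw : ∀ t, P (single t)) : P x := by
  induction x using Finsupp.induction_linear with
  | zero => exact h0
  | add f g hf hg => exact hadd f g hf hg
  | single a b =>
    have := hsmul b _ (hw a)
    rwa [Finsupp.smul_single, smul_eq_mul, mul_one] at this

theorem compLin_rel_left {m n p : ℕ} (h : p + 1 = m + n) (i : Fin n) {x : Word E m →₀ k}
    (hx : Rel x) (y : Word E n →₀ k) : Rel (compLin h i x y) := by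
  refine linear_induction (P := fun y => Rel (compLin h i x y)) y ?_ ?_ ?_ ?_
  · rw [map_zero]; exact Rel.zero
  · intro a b ha hb; rw [map_add]; exact Rel.add ha hb
  · intro c a ha; rw [map_smul]; exact Rel.smul c ha
  · intro t; exact Rel.comp_left h i t hx

theorem compLin_rel_right {m n p : ℕ} (h : p + 1 = m + n) (i : Fin n) (x : Word E m →₀ k)
    {y : Word E n →₀ k} (hy : Rel y) : Rel (compLin h i x y) := by
  refine linear_induction (P := fun x => Rel (compLin h i x y)) x ?_ ?_ ?_ ?_
  · rw [map_zero]; exact Rel.zero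
  · intro a b ha hb; rw [map_add]; exact Rel.add ha hb
  · intro c a ha; rw [map_smul]; exact Rel.smul c ha
  · intro t; exact Rel.comp_right h i t hy

/-- Projection of formal linear combinations onto the words of degree `e`. -/
noncomputable def projLin {n : ℕ} (e : ℤ) : (Word E n →₀ k) →ₗ[k] (Word E n →₀ k) :=
  Finsupp.linearCombination k fun t => if t.deg = e then single t else 0

theorem projLin_single {n : ℕ} (e : ℤ) (t : Word E n) :
    projLin e (single (k := k) t) = if t.deg = e then single t else 0 := by
  simp [projLin]

theorem projLin_actLin {n : ℕ} (e : ℤ) (σ : Perm (Fin n)) (x : Word E n →₀ k) :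
    projLin e (actLin σ x) = actLin σ (projLin e x) := by
  refine linear_induction (P := fun x => projLin e (actLin σ x) = actLin σ (projLin e x)) x
    (by simp) ?_ ?_ ?_
  · intro a b ha hb; simp only [map_add, ha, hb]
  · intro c a ha; simp only [map_smul, ha]
  · intro t
    rw [actLin_single, projLin_single, projLin_single, deg]
    split_ifs <;> simp

theorem projLin_comp_left {m n p : ℕ} (h : p + 1 = m + n) (i : Fin n) (e : ℤ)
    (x : Word E m →₀ k) (t : Word E n) :
    projLin e (compLin h i x (single t)) = compLin h i (projLin (e - t.deg) x) (single t) := by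
  refine linear_induction (P := fun x => projLin e (compLin h i x (single t)) =
    compLin h i (projLin (e - t.deg) x) (single t)) x (by simp) ?_ ?_ ?_
  · intro a b ha hb; simp only [map_add, LinearMap.add_apply, ha, hb]
  · intro c a ha; simp only [map_smul, LinearMap.smul_apply, ha]
  · intro s
    rw [compLin_single, projLin_single, projLin_single, deg]
    by_cases hs : s.deg + t.deg = e
    · rw [if_pos hs, if_pos (by omega), compLin_single]
    · rw [if_neg hs, if_neg (by omega)]; simp

theorem projLin_comp_right {m n p : ℕ} (h : p + 1 = m + n) (i : Fin n) (e : ℤ)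
    (s : Word E m) (y : Word E n →₀ k) :
    projLin e (compLin h i (single s) y) = compLin h i (single s) (projLin (e - s.deg) y) := by
  refine linear_induction (P := fun y => projLin e (compLin h i (single s) y) =
    compLin h i (single s) (projLin (e - s.deg) y)) y (by simp) ?_ ?_ ?_
  · intro a b ha hb; simp only [map_add, ha, hb]
  · intro c a ha; simp only [map_smul, ha]
  · intro t
    rw [compLin_single, projLin_single, projLin_single, deg]
    by_cases hs : s.deg + t.deg = e
    · rw [if_pos hs, if_pos (by omega), compLin_single]
    · rw [if_neg hs, if_neg (by omega)]; simp

/-- The relations are homogeneous. -/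
theorem projLin_rel {n : ℕ} {x : Word E n →₀ k} (hx : Rel x) : ∀ e, Rel (projLin e x) := by
  have two : ∀ {n : ℕ} (s t : Word E n) (c : k) (e : ℤ), s.deg = t.deg →
      Rel (single s - c • single t) → Rel (projLin e (single s - c • single t)) := by
    intro n s t c e hst hr
    rw [map_sub, map_smul, projLin_single, projLin_single, hst]
    split_ifs
    · exact hr
    · simpa using Rel.zero
  have two' : ∀ {n : ℕ} (s t : Word E n) (e : ℤ), s.deg = t.deg →
      Rel (single (k := k) s - single t) → Rel (projLin e (single (k := k) s - single t)) := by
    intro n s t e hst hr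
    have := two s t 1 e hst (by rwa [one_smul])
    rwa [one_smul] at this
  induction hx with
  | zero => intro e; rw [map_zero]; exact Rel.zero
  | add _ _ h1 h2 => intro e; rw [map_add]; exact Rel.add (h1 e) (h2 e)
  | smul c _ h1 => intro e; rw [map_smul]; exact Rel.smul c (h1 e)
  | act σ _ h1 => intro e; rw [projLin_actLin]; exact Rel.act σ (h1 e)
  | comp_left h i t hr h1 => intro e; rw [projLin_comp_left]; exact Rel.comp_left h i t (h1 _)
  | comp_right h i s hr h1 => intro e; rw [projLin_comp_right]; exact Rel.comp_right h i s (h1 _)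
  | @gen_add n' j z z' =>
    intro e
    rw [map_sub, map_sub, projLin_single, projLin_single, projLin_single]
    have hd : ∀ w : E.deg n' j, (gen j w : Word E n').deg = j := fun _ => by rw [deg]
    by_cases hj : j = e
    · rw [if_pos ((hd _).trans hj), if_pos ((hd _).trans hj), if_pos ((hd _).trans hj)]
      exact Rel.gen_add j z z'
    · rw [if_neg (fun hc => hj ((hd _).symm.trans hc)), if_neg (fun hc => hj ((hd _).symm.trans hc)),
        if_neg (fun hc => hj ((hd _).symm.trans hc)), sub_zero, sub_zero]
      exact Rel.zero
  | gen_smul j c z => exact fun e => two _ _ _ e rfl (Rel.gen_smul j c z)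
  | gen_act j σ z => exact fun e => two' _ _ e rfl (Rel.gen_act j σ z)
  | act_one t => exact fun e => two' _ _ e rfl (Rel.act_one t)
  | act_mul σ τ t => exact fun e => two' _ _ e rfl (Rel.act_mul σ τ t)
  | comp_seq h₁ h₂ h₃ h₄ i j s t x =>
    exact fun e => two' _ _ e (by simp only [deg]; ring) (Rel.comp_seq h₁ h₂ h₃ h₄ i j s t x)
  | comp_par h₁ h₂ h₃ h₄ i j hij s t x =>
    exact fun e => two _ _ _ e (by simp only [deg]; ring) (Rel.comp_par h₁ h₂ h₃ h₄ i j hij s t x)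
  | comp_act h j σ τ s t => exact fun e => two' _ _ e rfl (Rel.comp_act h j σ τ s t)

end Word

namespace FreeOperad

variable {k : Type u} [Field k] (E : Collection.{u, v} k)

open Word

/-- The underlying vector spaces of the free operad. -/
abbrev Carrier (n : ℕ) : Type (max u v) := (Word E n →₀ k) ⧸ relSubmodule E n

variable {E}

/-- The class of a word in the free operad. -/
noncomputable def mk {n : ℕ} (t : Word E n) : Carrier E n := (relSubmodule E n).mkQ (single t)

theorem mk_eq_of_rel {n : ℕ} (s t : Word E n) (c : k) (h : Rel (single s - c • single t)) :
    mk s = c • mk t := by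
  rw [mk, mk, ← map_smul]
  exact (Submodule.Quotient.eq _).2 h

theorem mk_eq_of_rel_one {n : ℕ} (s t : Word E n) (h : Rel (single (k := k) s - single t)) :
    mk s = mk t :=
  (Submodule.Quotient.eq _).2 h

theorem induction {n : ℕ} {P : Carrier E n → Prop} (x : Carrier E n) (h0 : P 0)
    (hadd : ∀ x y, P x → P y → P (x + y)) (hsmul : ∀ (c : k) x, P x → P (c • x))
    (hw : ∀ t, P (mk t)) : P x := by
  obtain ⟨x, rfl⟩ := (relSubmodule E n).mkQ_surjective x
  refine linear_induction (P := fun x => P ((relSubmodule E n).mkQ x)) x ?_ ?_ ?_ hw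
  · rwa [map_zero]
  · intro a b ha hb; rw [map_add]; exact hadd _ _ ha hb
  · intro c a ha; rw [map_smul]; exact hsmul _ _ ha

/-- Linear maps from the free operad agree if they agree on words. -/
theorem hom_ext {n : ℕ} {M : Type w} [AddCommGroup M] [Module k M] {f g : Carrier E n →ₗ[k] M}
    (h : ∀ t, f (mk t) = g (mk t)) : f = g := by
  refine LinearMap.ext fun x => ?_
  refine induction (P := fun x => f x = g x) x (by simp) ?_ ?_ h
  · intro a b ha hb; rw [map_add, map_add, ha, hb]
  · intro c a ha; rw [map_smul, map_smul, ha]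

/-- The action of the symmetric group on the free operad. -/
noncomputable def actMap {n : ℕ} (σ : Perm (Fin n)) : Carrier E n →ₗ[k] Carrier E n :=
  (relSubmodule E n).mapQ (relSubmodule E n) (actLin σ) fun _ hx => Rel.act σ hx

@[simp] theorem actMap_mk {n : ℕ} (σ : Perm (Fin n)) (t : Word E n) :
    actMap σ (mk t) = mk (act σ t) := by
  change (relSubmodule E n).mkQ (actLin σ (single t)) = _
  rw [actLin_single, mk]

/-- The partial compositions of the free operad. -/
noncomputable def compMap {m n p : ℕ} (h : p + 1 = m + n) (i : Fin n) :
    Carrier E m →ₗ[k] Carrier E n →ₗ[k] Carrier E p :=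
  (relSubmodule E m).liftQ
    { toFun := fun x => (relSubmodule E n).mapQ (relSubmodule E p) (compLin h i x)
        fun _ hy => compLin_rel_right h i x hy
      map_add' := fun x y => by
        apply Submodule.linearMap_qext
        refine LinearMap.ext fun z => ?_
        change (relSubmodule E p).mkQ (compLin h i (x + y) z) =
          (relSubmodule E p).mkQ (compLin h i x z) + (relSubmodule E p).mkQ (compLin h i y z)
        rw [map_add, LinearMap.add_apply, map_add]
      map_smul' := fun c x => by
        apply Submodule.linearMap_qext
        refine LinearMap.ext fun z => ?_
        change (relSubmodule E p).mkQ (compLin h i (c • x) z) =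
          c • (relSubmodule E p).mkQ (compLin h i x z)
        rw [map_smul, LinearMap.smul_apply, map_smul] }
    (fun x hx => by
      apply Submodule.linearMap_qext
      refine LinearMap.ext fun z => ?_
      exact (Submodule.Quotient.mk_eq_zero _).2 (compLin_rel_left h i hx z))

@[simp] theorem compMap_mk {m n p : ℕ} (h : p + 1 = m + n) (i : Fin n) (s : Word E m)
    (t : Word E n) : compMap h i (mk s) (mk t) = mk (comp h i s t) := by
  simp only [mk, ← compLin_single]
  rfl

/-- The span of the words of degree `j`. -/
noncomputable def degSubmodule (n : ℕ) (j : ℤ) : Submodule k (Carrier E n) :=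
  Submodule.span k {x | ∃ t : Word E n, t.deg = j ∧ mk t = x}

theorem mk_mem {n : ℕ} (t : Word E n) : mk t ∈ degSubmodule n t.deg :=
  Submodule.subset_span ⟨t, rfl, rfl⟩

/-- Projection onto the component of degree `e`. -/
noncomputable def projMap {n : ℕ} (e : ℤ) : Carrier E n →ₗ[k] Carrier E n :=
  (relSubmodule E n).mapQ (relSubmodule E n) (projLin e) fun _ hx => projLin_rel hx e

theorem projMap_mk {n : ℕ} (e : ℤ) (t : Word E n) :
    projMap e (mk t) = if t.deg = e then mk t else 0 := by
  change (relSubmodule E n).mkQ (projLin e (single t)) = _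
  rw [projLin_single]
  split_ifs
  · rfl
  · exact map_zero _

theorem deg_isInternal (n : ℕ) : DirectSum.IsInternal (degSubmodule (E := E) n) := by
  refine isInternal_of_projections _ ?_ projMap ?_ ?_
  · rw [eq_top_iff]
    intro x _
    refine induction (P := fun x => x ∈ ⨆ j, degSubmodule n j) x (Submodule.zero_mem _)
      (fun _ _ => Submodule.add_mem _) (fun c _ => Submodule.smul_mem _ c) fun t => ?_
    exact Submodule.mem_iSup_of_mem t.deg (mk_mem t)
  · intro j x hx
    induction hx using Submodule.span_induction with
    | mem x hx =>
      obtain ⟨t, ht, rfl⟩ := hx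
      rw [projMap_mk, if_pos ht]
    | zero => simp
    | add x y _ _ hx hy => rw [map_add, hx, hy]
    | smul c x _ hx => rw [map_smul, hx]
  · intro i j hij x hx
    induction hx using Submodule.span_induction with
    | mem x hx =>
      obtain ⟨t, ht, rfl⟩ := hx
      rw [projMap_mk, if_neg (by rw [ht]; exact hij)]
    | zero => simp
    | add x y _ _ hx hy => rw [map_add, hx, hy, add_zero]
    | smul c x _ hx => rw [map_smul, hx, smul_zero]

theorem mk_eq_zero_of_arity_zero {n : ℕ} (t : Word E n) (hn : n = 0) : mk t = 0 := by
  induction t with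
  | @gen n j z =>
    have := E.subsingleton_of_lt_two n (by omega)
    have hz : z = (0 : k) • z := Subsingleton.elim _ _
    have := mk_eq_of_rel _ _ _ (Rel.gen_smul (E := E) j (0 : k) z)
    rw [zero_smul k (mk _), ← hz] at this
    exact this
  | act σ t ih => rw [← actMap_mk, ih hn, map_zero]
  | comp h i s t ihs iht =>
    have := i.2
    rw [← compMap_mk, ihs (by omega), map_zero, LinearMap.zero_apply]

end FreeOperad

open FreeOperad in
/-- The free operad on a collection: formal linear combinations of words modulo the relations. -/
noncomputable def freeOperad {k : Type u} [Field k] (E : Collection.{u, v} k) :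
    Operad.{u, max u v} k where
  V := Carrier E
  act n :=
    { toFun := actMap
      map_one' := hom_ext fun t => by
        rw [actMap_mk]
        exact mk_eq_of_rel_one _ _ (Word.Rel.act_one t)
      map_mul' := fun σ τ => hom_ext fun t => by
        rw [Module.End.mul_apply, actMap_mk, actMap_mk, actMap_mk]
        exact mk_eq_of_rel_one _ _ (Word.Rel.act_mul σ τ t) }
  deg := degSubmodule
  isInternal := deg_isInternal
  act_mem := by
    intro n σ j x hx
    induction hx using Submodule.span_induction with
    | mem x hx =>
      obtain ⟨t, rfl, rfl⟩ := hx
      exact (actMap_mk σ t).symm ▸ mk_mem (Word.act σ t)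
    | zero => rw [map_zero]; exact Submodule.zero_mem _
    | add x y _ _ hx hy => rw [map_add]; exact Submodule.add_mem _ hx hy
    | smul c x _ hx => rw [map_smul]; exact Submodule.smul_mem _ c hx
  subsingleton_zero := by
    refine subsingleton_of_forall_eq 0 fun x => ?_
    refine induction (P := fun x => x = 0) x rfl ?_ ?_ ?_
    · rintro a b rfl rfl; simp
    · rintro c a rfl; simp
    · exact fun t => mk_eq_zero_of_arity_zero t rfl
  comp := compMap
  comp_mem := by
    intro m n p h i s t f g hf hg
    induction hf using Submodule.span_induction with
    | mem f hf =>
      obtain ⟨f, rfl, rfl⟩ := hf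
      induction hg using Submodule.span_induction with
      | mem g hg =>
        obtain ⟨g, rfl, rfl⟩ := hg
        rw [compMap_mk]
        exact mk_mem (Word.comp h i f g)
      | zero => rw [map_zero]; exact Submodule.zero_mem _
      | add x y _ _ hx hy => rw [map_add]; exact Submodule.add_mem _ hx hy
      | smul c x _ hx => rw [map_smul]; exact Submodule.smul_mem _ c hx
    | zero => rw [map_zero]; exact Submodule.zero_mem _
    | add x y _ _ hx hy => rw [map_add]; exact Submodule.add_mem _ hx hy
    | smul c x _ hx => rw [map_smul]; exact Submodule.smul_mem _ c hx
  comp_seq := by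
    intro a b c q r p h₁ h₂ h₃ h₄ i j f g x
    refine induction (P := fun f => compMap h₂ ⟨j + i, by omega⟩ f (compMap h₁ j g x) =
      compMap h₄ j (compMap h₃ i f g) x) f (by simp) ?_ ?_ fun f => ?_
    · intro a b ha hb; simp only [map_add, LinearMap.add_apply, ha, hb]
    · intro c a ha; simp only [map_smul, LinearMap.smul_apply, ha]
    refine induction (P := fun g => compMap h₂ ⟨j + i, by omega⟩ (mk f) (compMap h₁ j g x) =
      compMap h₄ j (compMap h₃ i (mk f) g) x) g (by simp) ?_ ?_ fun g => ?_
    · intro a b ha hb; simp only [map_add, LinearMap.add_apply, ha, hb]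
    · intro c a ha; simp only [map_smul, LinearMap.smul_apply, ha]
    refine induction (P := fun x => compMap h₂ ⟨j + i, by omega⟩ (mk f) (compMap h₁ j (mk g) x) =
      compMap h₄ j (compMap h₃ i (mk f) (mk g)) x) x (by simp) ?_ ?_ fun x => ?_
    · intro a b ha hb; simp only [map_add, ha, hb]
    · intro c a ha; simp only [map_smul, ha]
    simp only [compMap_mk]
    exact mk_eq_of_rel_one _ _ (Word.Rel.comp_seq h₁ h₂ h₃ h₄ i j f g x)
  comp_par := by
    intro a b c q r p h₁ h₂ h₃ h₄ i j hij s t f g x hf hg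
    induction hf using Submodule.span_induction with
    | mem f hf =>
      obtain ⟨f, rfl, rfl⟩ := hf
      induction hg using Submodule.span_induction with
      | mem g hg =>
        obtain ⟨g, rfl, rfl⟩ := hg
        refine induction (P := fun x => compMap h₂ ⟨i, by omega⟩ (mk f) (compMap h₁ j (mk g) x) =
          koszulSign k (f.deg * g.deg) • compMap h₄ ⟨j + a - 1, by omega⟩ (mk g)
            (compMap h₃ i (mk f) x)) x (by simp) ?_ ?_ fun x => ?_
        · intro a b ha hb; simp only [map_add, ha, hb, smul_add]
        · intro c a ha; simp only [map_smul, ha]; exact smul_comm _ _ _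
        simp only [compMap_mk]
        exact mk_eq_of_rel _ _ _ (Word.Rel.comp_par h₁ h₂ h₃ h₄ i j hij f g x)
      | zero => simp
      | add y z _ _ hy hz => simp only [map_add, LinearMap.add_apply, hy, hz, smul_add]
      | smul c y _ hy =>
        simp only [map_smul, LinearMap.smul_apply, hy]; exact smul_comm _ _ _
    | zero => simp
    | add y z _ _ hy hz => simp only [map_add, LinearMap.add_apply, hy, hz, smul_add]
    | smul c y _ hy =>
      simp only [map_smul, LinearMap.smul_apply, hy]; exact smul_comm _ _ _
  comp_act := by
    intro m n p h j σ τ f g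
    refine induction (P := fun f => compMap h (τ j) (actMap σ f) (actMap τ g) =
      actMap (insertPerm h σ τ j) (compMap h j f g)) f (by simp) ?_ ?_ fun f => ?_
    · intro a b ha hb; simp only [map_add, LinearMap.add_apply, ha, hb]
    · intro c a ha; simp only [map_smul, LinearMap.smul_apply, ha]
    refine induction (P := fun g => compMap h (τ j) (actMap σ (mk f)) (actMap τ g) =
      actMap (insertPerm h σ τ j) (compMap h j (mk f) g)) g (by simp) ?_ ?_ fun g => ?_
    · intro a b ha hb; simp only [map_add, ha, hb]
    · intro c a ha; simp only [map_smul, ha]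
    simp only [compMap_mk, actMap_mk]
    exact mk_eq_of_rel_one _ _ (Word.Rel.comp_act h j σ τ f g)

namespace FreeOperad

variable {k : Type u} [Field k] (E : Collection.{u, v} k)

variable {E}

/-- The element of the free operad given by a word. -/
noncomputable def word {n : ℕ} (t : Word E n) : (freeOperad E).V n := mk t

theorem act_word {n : ℕ} (σ : Perm (Fin n)) (t : Word E n) :
    (freeOperad E).act n σ (word t) = word (.act σ t) := actMap_mk σ t

theorem comp_word {m n p : ℕ} (h : p + 1 = m + n) (i : Fin n) (s : Word E m) (t : Word E n) :
    (freeOperad E).comp h i (word s) (word t) = word (.comp h i s t) := compMap_mk h i s t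

theorem deg_eq_span (n : ℕ) (j : ℤ) : (freeOperad E).deg n j =
    Submodule.span k {x | ∃ t : Word E n, t.deg = j ∧ word t = x} := rfl

/-- Induction on elements of the free operad. -/
theorem word_induction {n : ℕ} {P : (freeOperad E).V n → Prop} (x : (freeOperad E).V n) (h0 : P 0)
    (hadd : ∀ x y, P x → P y → P (x + y)) (hsmul : ∀ (c : k) x, P x → P (c • x))
    (hw : ∀ t, P (word t)) : P x :=
  induction (P := P) x h0 hadd hsmul hw

variable (E)

/-- The homogeneous elements of degree `j` of the collection, as elements of the free operad. -/
noncomputable def genLin (n : ℕ) (j : ℤ) : E.deg n j →ₗ[k] (freeOperad E).V n where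
  toFun z := word (Word.gen j z)
  map_add' z z' := by
    refine (Submodule.Quotient.eq (Word.relSubmodule E n)).2 ?_
    change Word.Rel (Word.single _ - (Word.single _ + Word.single _))
    rw [← sub_sub]
    exact Word.Rel.gen_add j z z'
  map_smul' c z := mk_eq_of_rel _ _ _ (Word.Rel.gen_smul j c z)

/-- The canonical map from a collection to the free operad. -/
noncomputable def ι (n : ℕ) : E.V n →ₗ[k] (freeOperad E).V n :=
  DirectSum.toModule k ℤ _ (genLin E n) ∘ₗ
    (LinearEquiv.ofBijective (DirectSum.coeLinearMap (E.deg n)) (E.isInternal n)).symm.toLinearMap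

theorem ι_of_mem {n : ℕ} {j : ℤ} (z : E.deg n j) : ι E n z = word (Word.gen j z) := by
  have : (LinearEquiv.ofBijective (DirectSum.coeLinearMap (E.deg n)) (E.isInternal n)).symm z
      = DirectSum.lof k ℤ (fun i => E.deg n i) j z := by
    rw [LinearEquiv.symm_apply_eq]
    exact (DirectSum.coeLinearMap_lof (E.deg n) j z).symm
  simp only [ι, LinearMap.comp_apply, LinearEquiv.coe_coe, this]
  rw [DirectSum.toModule_lof]
  rfl

/-- Evaluation of words in an operad. -/
noncomputable def eval {T : Operad.{u, w} k} (α : ∀ n, E.V n →ₗ[k] T.V n) :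
    ∀ {n : ℕ}, Word E n → T.V n
  | n, .gen _ z => α n z
  | n, .act σ t => T.act n σ (eval α t)
  | _, .comp h i s t => T.comp h i (eval α s) (eval α t)

theorem eval_mem {T : Operad.{u, w} k} {α : ∀ n, E.V n →ₗ[k] T.V n}
    (hdeg : ∀ n j x, x ∈ E.deg n j → α n x ∈ T.deg n j) {n : ℕ} (t : Word E n) :
    eval E α t ∈ T.deg n t.deg := by
  induction t with
  | gen j z => exact hdeg _ _ _ z.2
  | act σ t ih => exact T.act_mem σ ih
  | comp h i s t hs ht => exact T.comp_mem h i hs ht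

theorem eval_rel {T : Operad.{u, w} k} {α : ∀ n, E.V n →ₗ[k] T.V n}
    (hdeg : ∀ n j x, x ∈ E.deg n j → α n x ∈ T.deg n j)
    (hact : ∀ n σ x, α n (E.act n σ x) = T.act n σ (α n x)) {n : ℕ} {x : Word E n →₀ k}
    (hx : Word.Rel x) : Finsupp.linearCombination k (eval E α) x = 0 := by
  have hA : ∀ {n : ℕ} (σ : Perm (Fin n)) (x : Word E n →₀ k),
      Finsupp.linearCombination k (eval E α) (Word.actLin σ x) =
        T.act n σ (Finsupp.linearCombination k (eval E α) x) := by
    intro n σ x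
    refine Word.linear_induction (P := fun x => Finsupp.linearCombination k (eval E α)
      (Word.actLin σ x) = T.act n σ (Finsupp.linearCombination k (eval E α) x)) x
      (by simp) ?_ ?_ ?_
    · intro a b ha hb; simp only [map_add, ha, hb]
    · intro c a ha; simp only [map_smul, ha]
    · intro t; simp [eval]
  have hC : ∀ {m n p : ℕ} (h : p + 1 = m + n) (i : Fin n) (x : Word E m →₀ k)
      (y : Word E n →₀ k), Finsupp.linearCombination k (eval E α) (Word.compLin h i x y) =
        T.comp h i (Finsupp.linearCombination k (eval E α) x)
          (Finsupp.linearCombination k (eval E α) y) := by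
    intro m n p h i x y
    refine Word.linear_induction (P := fun x => Finsupp.linearCombination k (eval E α)
      (Word.compLin h i x y) = T.comp h i (Finsupp.linearCombination k (eval E α) x)
          (Finsupp.linearCombination k (eval E α) y)) x (by simp) ?_ ?_ ?_
    · intro a b ha hb; simp only [map_add, LinearMap.add_apply, ha, hb]
    · intro c a ha; simp only [map_smul, LinearMap.smul_apply, ha]
    intro s
    refine Word.linear_induction (P := fun y => Finsupp.linearCombination k (eval E α)
      (Word.compLin h i (Word.single s) y) =
        T.comp h i (Finsupp.linearCombination k (eval E α) (Word.single s))
          (Finsupp.linearCombination k (eval E α) y)) y (by simp) ?_ ?_ ?_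
    · intro a b ha hb; simp only [map_add, ha, hb]
    · intro c a ha; simp only [map_smul, ha]
    · intro t; simp [eval]
  have hL : ∀ {n : ℕ} (t : Word E n),
      Finsupp.linearCombination k (eval E α) (Word.single t) = eval E α t := by
    intro n t; simp
  induction hx with
  | zero => exact map_zero _
  | add _ _ h1 h2 => rw [map_add, h1, h2, add_zero]
  | smul c _ h1 => rw [map_smul, h1, smul_zero]
  | act σ _ h1 => rw [hA, h1, map_zero]
  | comp_left h i t _ h1 => rw [hC, h1, map_zero, LinearMap.zero_apply]
  | comp_right h i s _ h1 => rw [hC, h1, map_zero]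
  | gen_add j z z' => simp only [map_sub, hL, eval, Submodule.coe_add, map_add]; abel
  | gen_smul j c z => simp only [map_sub, map_smul, hL, eval, Submodule.coe_smul, sub_self]
  | gen_act j σ z => simp only [map_sub, hL, eval, hact, sub_self]
  | act_one t => simp only [map_sub, hL, eval, map_one, Module.End.one_apply, sub_self]
  | act_mul σ τ t => simp only [map_sub, hL, eval, map_mul, Module.End.mul_apply, sub_self]
  | comp_seq h₁ h₂ h₃ h₄ i j s t x =>
    simp only [map_sub, hL, eval]
    rw [T.comp_seq h₁ h₂ h₃ h₄, sub_self]
  | comp_par h₁ h₂ h₃ h₄ i j hij s t x =>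
    simp only [map_sub, map_smul, hL, eval]
    rw [T.comp_par h₁ h₂ h₃ h₄ i j hij _ (eval_mem E hdeg s) (eval_mem E hdeg t), sub_self]
  | comp_act h j σ τ s t =>
    simp only [map_sub, hL, eval]
    rw [T.comp_act, sub_self]

/-- The universal property of the free operad: homomorphisms from it correspond to maps of
collections. -/
theorem existsUnique_hom {T : Operad.{u, w} k} (α : ∀ n, E.V n →ₗ[k] T.V n)
    (hdeg : ∀ n j x, x ∈ E.deg n j → α n x ∈ T.deg n j)
    (hact : ∀ n σ x, α n (E.act n σ x) = T.act n σ (α n x)) :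
    ∃! φ : Operad.Hom (freeOperad E) T, ∀ n x, φ.map n (ι E n x) = α n x := by
  let φ : ∀ n, (freeOperad E).V n →ₗ[k] T.V n := fun n =>
    (Word.relSubmodule E n).liftQ (Finsupp.linearCombination k (eval E α))
      fun _ hx => eval_rel E hdeg hact hx
  have hφ : ∀ {n : ℕ} (t : Word E n), φ n (word t) = eval E α t := by
    intro n t
    change Finsupp.linearCombination k (eval E α) (Word.single t) = _
    simp
  refine ⟨⟨φ, ?_, ?_, ?_⟩, ?_, ?_⟩
  · intro n j x hx
    rw [deg_eq_span] at hx
    induction hx using Submodule.span_induction with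
    | mem x hx =>
      obtain ⟨t, rfl, rfl⟩ := hx
      rw [hφ]
      exact eval_mem E hdeg t
    | zero => rw [map_zero]; exact Submodule.zero_mem _
    | add x y _ _ hx hy => rw [map_add]; exact Submodule.add_mem _ hx hy
    | smul c x _ hx => rw [map_smul]; exact Submodule.smul_mem _ c hx
  · intro n σ x
    refine word_induction (P := fun x => φ n ((freeOperad E).act n σ x) = T.act n σ (φ n x)) x
      (by simp) ?_ ?_ ?_
    · intro a b ha hb; simp only [map_add, ha, hb]
    · intro c a ha; simp only [map_smul, ha]
    · intro t; rw [act_word, hφ, hφ, eval]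
  · intro m n p h i x y
    refine word_induction (P := fun x => φ p ((freeOperad E).comp h i x y) =
      T.comp h i (φ m x) (φ n y)) x (by simp) ?_ ?_ ?_
    · intro a b ha hb; simp only [map_add, LinearMap.add_apply, ha, hb]
    · intro c a ha; simp only [map_smul, LinearMap.smul_apply, ha]
    intro s
    refine word_induction (P := fun y => φ p ((freeOperad E).comp h i (word s) y) =
      T.comp h i (φ m (word s)) (φ n y)) y (by simp) ?_ ?_ ?_
    · intro a b ha hb; simp only [map_add, ha, hb]
    · intro c a ha; simp only [map_smul, ha]
    · intro t; rw [comp_word, hφ, hφ, hφ, eval]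
  · intro n x
    have hle : (⊤ : Submodule k (E.V n)) ≤ LinearMap.eqLocus (φ n ∘ₗ ι E n) (α n) := by
      rw [← E.iSup_deg n]
      refine iSup_le fun j z hz => ?_
      change φ n (ι E n (⟨z, hz⟩ : E.deg n j)) = _
      rw [ι_of_mem, hφ, eval]
    exact hle (Submodule.mem_top (x := x))
  · rintro ⟨ψ, h1, h2, h3⟩ hψ
    have : ψ = φ := by
      funext n
      refine LinearMap.ext fun x => ?_
      refine word_induction (P := fun x => ψ n x = φ n x) x (by simp) ?_ ?_ fun t => ?_
      · intro a b ha hb; rw [map_add, map_add, ha, hb]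
      · intro c a ha; rw [map_smul, map_smul, ha]
      rw [hφ]
      clear x
      induction t with
      | gen j z => rw [← ι_of_mem E z, eval]; exact hψ _ _
      | act σ t ih => rw [eval, ← ih, ← h2, act_word]
      | comp h i s t hs ht => rw [eval, ← hs, ← ht, ← h3, comp_word]
    subst this
    rfl

end FreeOperad

/-! ### Gradings of the free operad -/

/-- A decomposition `E = E⁰ ⊕ E¹ ⊕ ⋯` of a collection into subcollections. -/
structure Collection.Decomposition {k : Type u} [Field k] (E : Collection.{u, v} k) where
  piece : ℕ → ∀ n, Submodule k (E.V n)
  isInternal : ∀ n, DirectSum.IsInternal fun l => piece l n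
  act_mem : ∀ {l n : ℕ} (σ : Perm (Fin n)) {x : E.V n}, x ∈ piece l n → E.act n σ x ∈ piece l n
  /-- Each piece is a graded subspace for the inner grading. -/
  le_iSup_inf_deg : ∀ l n, piece l n ≤ ⨆ j, piece l n ⊓ E.deg n j

/-- `HasTJ P t l` says that the letters of the word `t` belong to pieces `E^{l₁}, E^{l₂}, …` of the
collection with `l₁ + l₂ + ⋯ = l`. -/
inductive Word.HasTJ {k : Type u} [Field k] {E : Collection.{u, v} k} (P : E.Decomposition) :
    ∀ {n : ℕ}, Word E n → ℕ → Prop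
  | gen {n l : ℕ} {j : ℤ} {z : E.deg n j} (hz : (z : E.V n) ∈ P.piece l n) :
      HasTJ P (Word.gen j z) l
  | act {n l : ℕ} (σ : Perm (Fin n)) {t : Word E n} : HasTJ P t l → HasTJ P (Word.act σ t) l
  | comp {m n p l l' : ℕ} (h : p + 1 = m + n) (i : Fin n) {s : Word E m} {t : Word E n} :
      HasTJ P s l → HasTJ P t l' → HasTJ P (Word.comp h i s t) (l + l')

namespace FreeOperad

variable {k : Type u} [Field k] {E : Collection.{u, v} k}

/-- The component of TJ-degree `l` of the free operad on a decomposed collection. -/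
noncomputable def tjPiece (P : E.Decomposition) (l n : ℕ) : Submodule k ((freeOperad E).V n) :=
  Submodule.span k {x | ∃ t : Word E n, t.HasTJ P l ∧ word t = x}

variable (E) in
/-- The part of the free operad spanned by the words of length at least `l`. -/
noncomputable def lengthGE (l n : ℕ) : Submodule k ((freeOperad E).V n) :=
  Submodule.span k {x | ∃ t : Word E n, l ≤ t.length ∧ word t = x}

end FreeOperad

/-! ### The homology operad -/

theorem koszulSign_mul_self (k : Type u) [Field k] (e : ℤ) :
    koszulSign k e * koszulSign k e = 1 := by
  unfold koszulSign
  rcases Int.even_or_odd e with h | h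
  · simp [Int.negOnePow_even e h]
  · simp [Int.negOnePow_odd e h]

namespace Operad

variable {k : Type u} [Field k] {S : Operad.{u, v} k} (d : Differential S)

namespace Differential

/-- The cycles of arity `n`. -/
def cycles (n : ℕ) : Submodule k (S.V n) := LinearMap.ker (d.map n)

/-- The boundaries of arity `n`, as a subspace of the cycles. -/
def boundaries (n : ℕ) : Submodule k (d.cycles n) :=
  (LinearMap.range (d.map n)).comap (d.cycles n).subtype

theorem mem_cycles {n : ℕ} {x : S.V n} : x ∈ d.cycles n ↔ d.map n x = 0 := Iff.rfl

theorem mem_boundaries {n : ℕ} {x : d.cycles n} :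
    x ∈ d.boundaries n ↔ ∃ y, d.map n y = x := Iff.rfl

theorem map_proj (n : ℕ) (j : ℤ) (x : S.V n) :
    d.map n (S.proj n j x) = S.proj n (j - 1) (d.map n x) := by
  have hle : (⊤ : Submodule k (S.V n)) ≤
      LinearMap.eqLocus (d.map n ∘ₗ S.proj n j) (S.proj n (j - 1) ∘ₗ d.map n) := by
    rw [← S.iSup_deg n]
    refine iSup_le fun i x hx => ?_
    change d.map n (S.proj n j x) = S.proj n (j - 1) (d.map n x)
    rw [S.proj_of_mem j hx, S.proj_of_mem (j - 1) (d.map_mem hx)]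
    by_cases h : i = j
    · rw [if_pos h, if_pos (by omega)]
    · rw [if_neg h, if_neg (by omega), map_zero]
  exact hle (Submodule.mem_top (x := x))

theorem proj_mem_cycles {n : ℕ} (j : ℤ) {x : S.V n} (hx : x ∈ d.cycles n) :
    S.proj n j x ∈ d.cycles n := by
  rw [mem_cycles, map_proj, d.mem_cycles.1 hx, map_zero]

theorem map_comp_cycle {m n p : ℕ} (h : p + 1 = m + n) (i : Fin n) (f : S.V m) {g : S.V n}
    (hg : g ∈ d.cycles n) : d.map p (S.comp h i f g) = S.comp h i (d.map m f) g := by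
  refine S.mem_of_proj_mem (LinearMap.eqLocus (d.map p ∘ₗ (S.comp h i).flip g)
    ((S.comp h i).flip g ∘ₗ d.map m)) f fun j => ?_
  change d.map p (S.comp h i (S.proj m j f) g) = S.comp h i (d.map m (S.proj m j f)) g
  rw [d.leibniz h i g (S.proj_mem m j f), d.mem_cycles.1 hg, map_zero, smul_zero, add_zero]

theorem comp_mem_cycles {m n p : ℕ} (h : p + 1 = m + n) (i : Fin n) {f : S.V m} {g : S.V n}
    (hf : f ∈ d.cycles m) (hg : g ∈ d.cycles n) : S.comp h i f g ∈ d.cycles p := by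
  rw [mem_cycles, d.map_comp_cycle h i f hg, d.mem_cycles.1 hf, map_zero, LinearMap.zero_apply]

theorem comp_map_mem_range {m n p : ℕ} (h : p + 1 = m + n) (i : Fin n) {f : S.V m} (g : S.V n)
    (hf : f ∈ d.cycles m) : S.comp h i f (d.map n g) ∈ LinearMap.range (d.map p) := by
  refine S.mem_of_proj_mem ((LinearMap.range (d.map p)).comap
    ((S.comp h i).flip (d.map n g))) f fun j => ?_
  change S.comp h i (S.proj m j f) (d.map n g) ∈ LinearMap.range (d.map p)
  refine ⟨koszulSign k (-1 * j) • S.comp h i (S.proj m j f) g, ?_⟩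
  rw [map_smul, d.leibniz h i g (S.proj_mem m j f), d.mem_cycles.1 (d.proj_mem_cycles j hf),
    map_zero, LinearMap.zero_apply, zero_add, smul_smul, koszulSign_mul_self, one_smul]

/-- The homology of arity `n`. -/
abbrev HomologyCarrier (n : ℕ) : Type v := d.cycles n ⧸ d.boundaries n

/-- The homology class of a cycle. -/
def cls (n : ℕ) : d.cycles n →ₗ[k] d.HomologyCarrier n := (d.boundaries n).mkQ

theorem cls_surjective (n : ℕ) : Function.Surjective (d.cls n) := Submodule.mkQ_surjective _

theorem cls_eq_zero {n : ℕ} {x : d.cycles n} : d.cls n x = 0 ↔ ∃ y, d.map n y = x :=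
  (Submodule.Quotient.mk_eq_zero _).trans d.mem_boundaries

/-- The action of a permutation on cycles. -/
def actCycles {n : ℕ} (σ : Perm (Fin n)) : d.cycles n →ₗ[k] d.cycles n :=
  (S.act n σ).restrict fun x hx => by
    rw [mem_cycles, d.map_act, d.mem_cycles.1 hx, map_zero]

/-- The action of a permutation on homology. -/
def actHomology {n : ℕ} (σ : Perm (Fin n)) : d.HomologyCarrier n →ₗ[k] d.HomologyCarrier n :=
  (d.boundaries n).mapQ (d.boundaries n) (d.actCycles σ) fun x hx => by
    obtain ⟨y, hy⟩ := d.mem_boundaries.1 hx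
    exact d.mem_boundaries.2 ⟨S.act n σ y, by rw [d.map_act, hy]; rfl⟩

theorem actHomology_cls {n : ℕ} (σ : Perm (Fin n)) (x : d.cycles n) :
    d.actHomology σ (d.cls n x) = d.cls n (d.actCycles σ x) := rfl

/-- The composite of two cycles. -/
def compCycles {m n p : ℕ} (h : p + 1 = m + n) (i : Fin n) :
    d.cycles m →ₗ[k] d.cycles n →ₗ[k] d.cycles p :=
  LinearMap.mk₂ k (fun f g => ⟨S.comp h i f g, d.comp_mem_cycles h i f.2 g.2⟩)
    (fun _ _ _ => Subtype.ext (by simp)) (fun _ _ _ => Subtype.ext (by simp))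
    (fun _ _ _ => Subtype.ext (by simp)) (fun _ _ _ => Subtype.ext (by simp))

/-- The partial compositions of the homology operad. -/
def compHomology {m n p : ℕ} (h : p + 1 = m + n) (i : Fin n) :
    d.HomologyCarrier m →ₗ[k] d.HomologyCarrier n →ₗ[k] d.HomologyCarrier p :=
  (d.boundaries m).liftQ
    (LinearMap.flip ((d.boundaries n).liftQ ((d.compCycles h i).compr₂ (d.cls p)).flip
      (fun g hg => by
        obtain ⟨y, hy⟩ := d.mem_boundaries.1 hg
        refine LinearMap.ext fun f => (d.cls_eq_zero).2 ?_
        obtain ⟨w, hw⟩ := d.comp_map_mem_range h i y f.2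
        exact ⟨w, by rw [hw, hy]; rfl⟩)))
    (fun f hf => by
      obtain ⟨y, hy⟩ := d.mem_boundaries.1 hf
      refine LinearMap.ext fun g => ?_
      obtain ⟨g, rfl⟩ := d.cls_surjective n g
      exact (d.cls_eq_zero).2 ⟨S.comp h i y g, by rw [d.map_comp_cycle h i y g.2, hy]; rfl⟩)

theorem compHomology_cls {m n p : ℕ} (h : p + 1 = m + n) (i : Fin n) (f : d.cycles m)
    (g : d.cycles n) :
    d.compHomology h i (d.cls m f) (d.cls n g) = d.cls p (d.compCycles h i f g) := rfl

/-- The part of the homology represented by the cycles lying in a given subspace. -/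
def homologyPiece {n : ℕ} (A : Submodule k (S.V n)) : Submodule k (d.HomologyCarrier n) :=
  (A.comap (d.cycles n).subtype).map (d.cls n)

theorem mem_homologyPiece {n : ℕ} {A : Submodule k (S.V n)} {x : d.HomologyCarrier n} :
    x ∈ d.homologyPiece A ↔ ∃ z : d.cycles n, (z : S.V n) ∈ A ∧ d.cls n z = x := Iff.rfl

/-- Projection of homology onto a component of the inner grading. -/
noncomputable def projHomology (n : ℕ) (j : ℤ) : d.HomologyCarrier n →ₗ[k] d.HomologyCarrier n :=
  (d.boundaries n).mapQ (d.boundaries n)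
    ((S.proj n j).restrict fun _ hx => d.proj_mem_cycles j hx) fun x hx => by
      obtain ⟨y, hy⟩ := d.mem_boundaries.1 hx
      refine d.mem_boundaries.2 ⟨S.proj n (j + 1) y, ?_⟩
      rw [map_proj, add_sub_cancel_right, hy]
      rfl

theorem projHomology_cls {n : ℕ} {i j : ℤ} {x : d.cycles n} (hx : (x : S.V n) ∈ S.deg n i) :
    d.projHomology n j (d.cls n x) = if i = j then d.cls n x else 0 := by
  have h1 : d.projHomology n j (d.cls n x) =
    d.cls n ⟨S.proj n j x, d.proj_mem_cycles j x.2⟩ := rfl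
  have h2 := S.proj_of_mem j hx
  rw [h1]
  split_ifs with h
  · exact congrArg _ (Subtype.ext (h2.trans (if_pos h)))
  · rw [← map_zero (d.cls n)]
    exact congrArg _ (Subtype.ext (h2.trans (if_neg h)))

theorem homology_isInternal (n : ℕ) :
    DirectSum.IsInternal fun j => d.homologyPiece (S.deg n j) := by
  refine isInternal_of_projections _ ?_ (d.projHomology n) ?_ ?_
  · rw [eq_top_iff]
    intro x _
    obtain ⟨⟨x, hx⟩, rfl⟩ := d.cls_surjective n x
    have : x ∈ ((⨆ j, d.homologyPiece (S.deg n j)).comap (d.cls n)).map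
        (d.cycles n).subtype := by
      refine S.mem_of_proj_mem _ x fun j => ?_
      refine ⟨⟨S.proj n j x, d.proj_mem_cycles j hx⟩, ?_, rfl⟩
      exact Submodule.mem_iSup_of_mem j (d.mem_homologyPiece.2 ⟨_, S.proj_mem n j x, rfl⟩)
    obtain ⟨y, hy, rfl⟩ := this
    exact hy
  · intro j x hx
    obtain ⟨z, hz, rfl⟩ := d.mem_homologyPiece.1 hx
    rw [d.projHomology_cls hz, if_pos rfl]
  · intro i j hij x hx
    obtain ⟨z, hz, rfl⟩ := d.mem_homologyPiece.1 hx
    rw [d.projHomology_cls hz, if_neg hij]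

/-- The homology operad of a differential operad. -/
def homology : Operad.{u, v} k where
  V := d.HomologyCarrier
  act n :=
    { toFun := d.actHomology
      map_one' := by
        refine LinearMap.ext fun x => ?_
        obtain ⟨x, rfl⟩ := d.cls_surjective n x
        rw [actHomology_cls]
        exact congrArg (d.cls n) (Subtype.ext (by simp [actCycles]))
      map_mul' := fun σ τ => by
        refine LinearMap.ext fun x => ?_
        obtain ⟨x, rfl⟩ := d.cls_surjective n x
        rw [Module.End.mul_apply, actHomology_cls, actHomology_cls, actHomology_cls]
        exact congrArg (d.cls n) (Subtype.ext (by simp [actCycles])) }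
  deg n j := d.homologyPiece (S.deg n j)
  isInternal := d.homology_isInternal
  act_mem := by
    intro n σ j x hx
    obtain ⟨z, hz, rfl⟩ := d.mem_homologyPiece.1 hx
    exact d.mem_homologyPiece.2 ⟨d.actCycles σ z, S.act_mem σ hz, rfl⟩
  subsingleton_zero := by
    have := S.subsingleton_zero
    exact (d.cls_surjective 0).subsingleton
  comp := d.compHomology
  comp_mem := by
    intro m n p h i s t f g hf hg
    obtain ⟨f, hf', rfl⟩ := d.mem_homologyPiece.1 hf
    obtain ⟨g, hg', rfl⟩ := d.mem_homologyPiece.1 hg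
    exact d.mem_homologyPiece.2 ⟨d.compCycles h i f g, S.comp_mem h i hf' hg', rfl⟩
  comp_seq := by
    intro a b c q r p h₁ h₂ h₃ h₄ i j f g x
    obtain ⟨f, rfl⟩ := d.cls_surjective _ f
    obtain ⟨g, rfl⟩ := d.cls_surjective _ g
    obtain ⟨x, rfl⟩ := d.cls_surjective _ x
    simp only [compHomology_cls]
    exact congrArg (d.cls p) (Subtype.ext (S.comp_seq h₁ h₂ h₃ h₄ i j f.1 g.1 x.1))
  comp_par := by
    intro a b c q r p h₁ h₂ h₃ h₄ i j hij s t f g x hf hg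
    obtain ⟨f, hf', rfl⟩ := d.mem_homologyPiece.1 hf
    obtain ⟨g, hg', rfl⟩ := d.mem_homologyPiece.1 hg
    obtain ⟨x, rfl⟩ := d.cls_surjective _ x
    simp only [compHomology_cls]
    rw [← map_smul (d.cls p)]
    exact congrArg (d.cls p) (Subtype.ext (S.comp_par h₁ h₂ h₃ h₄ i j hij x.1 hf' hg'))
  comp_act := by
    intro m n p h j σ τ f g
    obtain ⟨f, rfl⟩ := d.cls_surjective _ f
    obtain ⟨g, rfl⟩ := d.cls_surjective _ g
    simp only [MonoidHom.coe_mk, OneHom.coe_mk, actHomology_cls, compHomology_cls]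
    exact congrArg (d.cls p) (Subtype.ext (S.comp_act h j σ τ f.1 g.1))

end Differential

/-- The homomorphism `H(S, d) → T` induced by a homomorphism `(S, d) → (T, 0)` of differential
operads; here the homology of `(T, 0)` is identified with `T`. -/
def Hom.homologyDesc {T : Operad.{u, w} k} (φ : Hom S T) (hφ : φ.Commutes d T.zeroDifferential) :
    Hom d.homology T where
  map n := (d.boundaries n).liftQ (φ.map n ∘ₗ (d.cycles n).subtype) fun x hx => by
    obtain ⟨y, hy⟩ := d.mem_boundaries.1 hx
    change φ.map n x = 0
    rw [← hy, hφ]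
    rfl
  map_mem := by
    intro n j x hx
    obtain ⟨z, hz, rfl⟩ := d.mem_homologyPiece.1 hx
    exact φ.map_mem hz
  map_act := by
    intro n σ x
    obtain ⟨x, rfl⟩ := d.cls_surjective _ x
    exact φ.map_act σ x.1
  map_comp := by
    intro m n p h i f g
    obtain ⟨f, rfl⟩ := d.cls_surjective _ f
    obtain ⟨g, rfl⟩ := d.cls_surjective _ g
    exact φ.map_comp h i f.1 g.1

end Operad

/-!
The generators are attached arity by arity, as cells are attached in homotopy theory. Suppose that
`Z` has generators of arity less than `n` only and that `ρ` is a resolution in those arities. In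
arity `n` the cone of `ρ` has the cycles `(x, h)` with `d x = 0` and `ρ x = 0`, and the boundaries
`(d y, ρ y)`. One adds generators `z` of arity `n` with `(d z, ρ z)` running through a complement
of the boundaries in the cycles; it can be chosen equivariant because `k` has characteristic zero
(Maschke's theorem). The generators with `d z = 0` have TJ-degree `0`, and those with `ρ z = 0` have
TJ-degree one more than `d z`.

Since `F(Z)(1) = 0`, every composition involving a new generator and another letter has arity
greater than `n`. So in arity `n` the free operad grows only by the new generators themselves: they
kill the homology of the cone and, being mapped injectively to a complement of the boundaries,
create no new cycles. The smaller arities are not disturbed. Finally `d z` has at least two letters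
because it lies in arity `n` of the free operad on generators of smaller arity.
-/

universe w₁

theorem koszulSign_add (k : Type u) [Field k] (a b : ℤ) :
    koszulSign k (a + b) = koszulSign k a * koszulSign k b := by
  simp [koszulSign, Int.negOnePow_add]

section Internal

variable {k : Type u} [Field k] {I κ : Type*} [DecidableEq I] [DecidableEq κ]
  {M : Type v} {N : Type w} [AddCommGroup M] [Module k M] [AddCommGroup N] [Module k N]
  {A : I → Submodule k M} {B : I → Submodule k N}

theorem isInternal_prod (hA : DirectSum.IsInternal A) (hB : DirectSum.IsInternal B) :
    DirectSum.IsInternal fun i => (A i).prod (B i) := by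
  apply DirectSum.isInternal_submodule_of_iSupIndep_of_iSup_eq_top
  · intro i
    have hle : ⨆ j, ⨆ (_ : j ≠ i), (A j).prod (B j) ≤
        (⨆ j, ⨆ (_ : j ≠ i), A j).prod (⨆ j, ⨆ (_ : j ≠ i), B j) :=
      iSup₂_le fun j hj => Submodule.prod_mono (le_iSup₂_of_le j hj le_rfl)
        (le_iSup₂_of_le j hj le_rfl)
    refine Disjoint.mono_right hle ?_
    rw [disjoint_iff, Submodule.prod_inf_prod, (hA.submodule_iSupIndep i).eq_bot,
      (hB.submodule_iSupIndep i).eq_bot, Submodule.prod_bot]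
  · rw [eq_top_iff, ← LinearMap.sup_range_inl_inr, LinearMap.range_eq_map, LinearMap.range_eq_map,
      ← hA.submodule_iSup_eq_top, ← hB.submodule_iSup_eq_top, Submodule.map_iSup,
      Submodule.map_iSup]
    refine sup_le (iSup_mono fun i => ?_) (iSup_mono fun i => ?_)
    · exact Submodule.map_le_iff_le_comap.2 fun x hx => ⟨hx, Submodule.zero_mem _⟩
    · exact Submodule.map_le_iff_le_comap.2 fun y hy => ⟨Submodule.zero_mem _, hy⟩

theorem isInternal_reindex (hA : DirectSum.IsInternal A) (f : κ ≃ I) :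
    DirectSum.IsInternal fun a => A (f a) := by
  apply DirectSum.isInternal_submodule_of_iSupIndep_of_iSup_eq_top
  · exact hA.submodule_iSupIndep.comp f.injective
  · rw [← hA.submodule_iSup_eq_top]
    exact f.iSup_comp (g := A)

end Internal

namespace SymSeq

variable {k : Type u} [Field k]

/-- A homomorphism of sequences of graded representations: equivariant linear maps of degree
zero. Maps of degree `e` are homomorphisms to a shift, see `SymSeq.shift`. -/
structure Hom (S : SymSeq.{u, v} k) (T : SymSeq.{u, w} k) where
  map : ∀ n, S.V n →ₗ[k] T.V n
  map_mem : ∀ {n : ℕ} {j : ℤ} {x : S.V n}, x ∈ S.deg n j → map n x ∈ T.deg n j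
  map_act : ∀ {n : ℕ} (σ : Perm (Fin n)) (x : S.V n), map n (S.act n σ x) = T.act n σ (map n x)

/-- The direct sum, taken in each arity. -/
abbrev prod (S : SymSeq.{u, v} k) (T : SymSeq.{u, w} k) : SymSeq.{u, max v w} k where
  V n := S.V n × T.V n
  act n :=
    { toFun := fun σ => (S.act n σ).prodMap (T.act n σ)
      map_one' := by ext <;> simp
      map_mul' := fun σ τ => by ext <;> simp }
  deg n j := (S.deg n j).prod (T.deg n j)
  isInternal n := isInternal_prod (S.isInternal n) (T.isInternal n)
  act_mem σ _ _ hx := ⟨S.act_mem σ hx.1, T.act_mem σ hx.2⟩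

/-- The shift of the grading: an element of degree `j + e` gets degree `j`. -/
abbrev shift (S : SymSeq.{u, v} k) (e : ℤ) : SymSeq.{u, v} k where
  V := S.V
  act := S.act
  deg n j := S.deg n (j + e)
  isInternal n := isInternal_reindex (S.isInternal n) (Equiv.addRight e)
  act_mem σ _ _ hx := S.act_mem σ hx

namespace Hom

variable {S : SymSeq.{u, v} k} {T : SymSeq.{u, w} k} {U : SymSeq.{u, w₁} k}

/-- The composite of two homomorphisms. -/
def comp (ψ : Hom T U) (φ : Hom S T) : Hom S U where
  map n := ψ.map n ∘ₗ φ.map n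
  map_mem hx := ψ.map_mem (φ.map_mem hx)
  map_act σ x := by simp [φ.map_act, ψ.map_act]

/-- The homomorphism to a direct sum with given components. -/
def prod (φ : Hom S T) (ψ : Hom S U) : Hom S (T.prod U) where
  map n := (φ.map n).prod (ψ.map n)
  map_mem hx := ⟨φ.map_mem hx, ψ.map_mem hx⟩
  map_act σ x := Prod.ext (φ.map_act σ x) (ψ.map_act σ x)

/-- The homomorphism from a direct sum with given components. -/
def coprod (φ : Hom S U) (ψ : Hom T U) : Hom (S.prod T) U where
  map n := (φ.map n).coprod (ψ.map n)
  map_mem hx := Submodule.add_mem _ (φ.map_mem hx.1) (ψ.map_mem hx.2)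
  map_act σ x := by simp [φ.map_act, ψ.map_act]

/-- The projection of a direct sum to the first summand. -/
def fst (S : SymSeq.{u, v} k) (T : SymSeq.{u, w} k) : Hom (S.prod T) S where
  map _ := LinearMap.fst k _ _
  map_mem hx := hx.1
  map_act _ _ := rfl

/-- The projection of a direct sum to the second summand. -/
def snd (S : SymSeq.{u, v} k) (T : SymSeq.{u, w} k) : Hom (S.prod T) T where
  map _ := LinearMap.snd k _ _
  map_mem hx := hx.2
  map_act _ _ := rfl

/-- The zero homomorphism. -/
def zero (S : SymSeq.{u, v} k) (T : SymSeq.{u, w} k) : Hom S T where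
  map _ := 0
  map_mem _ := Submodule.zero_mem _
  map_act _ _ := (map_zero _).symm

/-- A homomorphism regarded as one between shifts. -/
def shift (φ : Hom S T) (e : ℤ) : Hom (S.shift e) (T.shift e) where
  map := φ.map
  map_mem hx := φ.map_mem hx
  map_act := φ.map_act

end Hom

variable (S : SymSeq.{u, v} k)

theorem hom_ext_of_deg {n : ℕ} {M : Type w} [AddCommGroup M] [Module k M] {f g : S.V n →ₗ[k] M}
    (h : ∀ j, ∀ x ∈ S.deg n j, f x = g x) : f = g := by
  have hle : (⊤ : Submodule k (S.V n)) ≤ LinearMap.eqLocus f g := by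
    rw [← S.iSup_deg n]
    exact iSup_le fun j x hx => h j x hx
  exact LinearMap.ext fun x => hle (Submodule.mem_top (x := x))

/-- The operator multiplying the elements of degree `j` by `(-1)^(e * j)`. -/
noncomputable def signOp (e : ℤ) (n : ℕ) : S.V n →ₗ[k] S.V n :=
  DirectSum.toModule k ℤ _ (fun j => koszulSign k (e * j) • (S.deg n j).subtype) ∘ₗ
    (LinearEquiv.ofBijective (DirectSum.coeLinearMap (S.deg n)) (S.isInternal n)).symm.toLinearMap

variable {S}

theorem signOp_of_mem (e : ℤ) {n : ℕ} {j : ℤ} {x : S.V n} (hx : x ∈ S.deg n j) :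
    S.signOp e n x = koszulSign k (e * j) • x := by
  have hsymm : (LinearEquiv.ofBijective (DirectSum.coeLinearMap (S.deg n)) (S.isInternal n)).symm x
      = DirectSum.lof k ℤ (fun i => S.deg n i) j ⟨x, hx⟩ := by
    rw [LinearEquiv.symm_apply_eq]
    exact (DirectSum.coeLinearMap_lof (S.deg n) j ⟨x, hx⟩).symm
  simp only [signOp, LinearMap.comp_apply, LinearEquiv.coe_coe, hsymm, DirectSum.toModule_lof]
  rfl

theorem signOp_mem (e : ℤ) {n : ℕ} {j : ℤ} {x : S.V n} (hx : x ∈ S.deg n j) :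
    S.signOp e n x ∈ S.deg n j := by
  rw [signOp_of_mem e hx]
  exact Submodule.smul_mem _ _ hx

theorem signOp_act (e : ℤ) {n : ℕ} (σ : Perm (Fin n)) (x : S.V n) :
    S.signOp e n (S.act n σ x) = S.act n σ (S.signOp e n x) := by
  have : S.signOp e n ∘ₗ S.act n σ = S.act n σ ∘ₗ S.signOp e n := by
    refine S.hom_ext_of_deg fun j x hx => ?_
    simp only [LinearMap.comp_apply, signOp_of_mem e (S.act_mem σ hx), signOp_of_mem e hx, map_smul]
  exact LinearMap.congr_fun this x

theorem Hom.map_proj {T : SymSeq.{u, w} k} (φ : Hom S T) (n : ℕ) (j : ℤ) (x : S.V n) :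
    φ.map n (S.proj n j x) = T.proj n j (φ.map n x) := by
  have : φ.map n ∘ₗ S.proj n j = T.proj n j ∘ₗ φ.map n := by
    refine S.hom_ext_of_deg fun i x hx => ?_
    simp only [LinearMap.comp_apply, S.proj_of_mem j hx, T.proj_of_mem j (φ.map_mem hx)]
    split_ifs <;> simp
  exact LinearMap.congr_fun this x

end SymSeq

namespace Operad

variable {k : Type u} [Field k]

/-- The homomorphism of sequences of representations underlying a homomorphism of operads. -/
def Hom.toSymSeqHom {S : Operad.{u, v} k} {T : Operad.{u, w} k} (φ : Hom S T) :
    S.toSymSeq.Hom T.toSymSeq where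
  __ := φ

/-- A derivation of degree `e` regarded as a homomorphism to the shift. -/
def Derivation.toSymSeqHom {S : Operad.{u, v} k} {e : ℤ} (D : Derivation S e) :
    S.toSymSeq.Hom (S.toSymSeq.shift e) where
  __ := D

/-- The composite of two homomorphisms of operads. -/
def Hom.comp {S : Operad.{u, v} k} {T : Operad.{u, w} k} {U : Operad.{u, w₁} k} (ψ : Hom T U)
    (φ : Hom S T) : Hom S U where
  map n := ψ.map n ∘ₗ φ.map n
  map_mem hx := ψ.map_mem (φ.map_mem hx)
  map_act σ x := by simp [φ.map_act, ψ.map_act]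
  map_comp h i f g := by simp [φ.map_comp, ψ.map_comp]

/-- The identity homomorphism. -/
def Hom.id (S : Operad.{u, v} k) : Hom S S where
  map _ := LinearMap.id
  map_mem hx := hx
  map_act _ _ := rfl
  map_comp _ _ _ _ := rfl

/-- The zero maps: a homomorphism because operads are nonunital. -/
def Hom.zero (S : Operad.{u, v} k) (T : Operad.{u, w} k) : Hom S T where
  map _ := 0
  map_mem _ := Submodule.zero_mem _
  map_act _ _ := by simp
  map_comp _ _ _ _ := by simp

variable (S : Operad.{u, v} k)

theorem signOp_comp (e : ℤ) {m n p : ℕ} (h : p + 1 = m + n) (i : Fin n) (f : S.V m) (g : S.V n) :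
    S.signOp e p (S.comp h i f g) = S.comp h i (S.signOp e m f) (S.signOp e n g) := by
  have : (S.comp h i).compr₂ (S.signOp e p) =
      (S.comp h i).compl₁₂ (S.signOp e m) (S.signOp e n) := by
    refine S.hom_ext_of_deg fun s f hf => S.hom_ext_of_deg fun t g hg => ?_
    simp only [LinearMap.compr₂_apply, LinearMap.compl₁₂_apply]
    rw [SymSeq.signOp_of_mem e hf, SymSeq.signOp_of_mem e hg,
      SymSeq.signOp_of_mem e (S.comp_mem h i hf hg), mul_add, koszulSign_add]
    simp only [map_smul, LinearMap.smul_apply, smul_smul, mul_comm]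
  exact LinearMap.congr_fun (LinearMap.congr_fun this f) g

/-- The partial composition of the square zero extension `S ⊕ εS`, with `ε` moved to the left. -/
noncomputable def dualComp (e : ℤ) {m n p : ℕ} (h : p + 1 = m + n) (i : Fin n) :
    S.V m × S.V m →ₗ[k] S.V n × S.V n →ₗ[k] S.V p × S.V p :=
  LinearMap.mk₂ k
    (fun f g => (S.comp h i f.1 g.1, S.comp h i f.2 g.1 + S.comp h i (S.signOp e m f.1) g.2))
    (fun _ _ _ => Prod.ext (by simp) (by simp; abel))
    (fun _ _ _ => Prod.ext (by simp) (by simp))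
    (fun _ _ _ => Prod.ext (by simp) (by simp; abel))
    (fun _ _ _ => Prod.ext (by simp) (by simp))

theorem dualComp_par (e : ℤ) {a b c q r p : ℕ} (h₁ : q + 1 = b + c) (h₂ : p + 1 = a + q)
    (h₃ : r + 1 = a + c) (h₄ : p + 1 = b + r) (i j : Fin c) (hij : i < j) {s t : ℤ}
    {f : S.V a × S.V a} {g : S.V b × S.V b} (x : S.V c × S.V c)
    (hf : f ∈ (S.deg a s).prod (S.deg a (s + e))) (hg : g ∈ (S.deg b t).prod (S.deg b (t + e))) :
    S.dualComp e h₂ ⟨i, by omega⟩ f (S.dualComp e h₁ j g x) =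
      koszulSign k (s * t) • S.dualComp e h₄ ⟨j + a - 1, by omega⟩ g (S.dualComp e h₃ i f x) := by
  refine Prod.ext (S.comp_par h₁ h₂ h₃ h₄ i j hij x.1 hf.1 hg.1) ?_
  simp only [dualComp, LinearMap.mk₂_apply, map_add, Prod.smul_snd]
  rw [S.comp_par h₁ h₂ h₃ h₄ i j hij x.1 hf.2 hg.1,
    S.comp_par h₁ h₂ h₃ h₄ i j hij x.1 (SymSeq.signOp_mem e hf.1) hg.2,
    S.comp_par h₁ h₂ h₃ h₄ i j hij x.2 (SymSeq.signOp_mem e hf.1) (SymSeq.signOp_mem e hg.1),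
    SymSeq.signOp_of_mem e hf.1, SymSeq.signOp_of_mem e hg.1]
  simp only [map_smul, LinearMap.smul_apply, smul_add, smul_smul, add_mul, mul_add,
    koszulSign_add]
  rw [add_left_comm, mul_comm s e, mul_assoc (koszulSign k (s * t)) (koszulSign k (e * s)),
    koszulSign_mul_self, mul_one]

/-- The square zero extension `S ⊕ εS` of an operad, `ε` being of degree `-e`: homomorphisms to
it over `S` are derivations of degree `e`. -/
noncomputable def dualNumbers (e : ℤ) : Operad.{u, v} k where
  toSymSeq := S.toSymSeq.prod (S.toSymSeq.shift e)
  subsingleton_zero := by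
    have := S.subsingleton_zero
    infer_instance
  comp h i := S.dualComp e h i
  comp_mem := by
    intro m n p h i s t f g hf hg
    refine ⟨S.comp_mem h i hf.1 hg.1, Submodule.add_mem _ ?_ ?_⟩
    · have := S.comp_mem h i hf.2 hg.1
      rwa [add_right_comm] at this
    · have := S.comp_mem h i (SymSeq.signOp_mem e hf.1) hg.2
      rwa [← add_assoc] at this
  comp_seq := by
    intro a b c q r p h₁ h₂ h₃ h₄ i j f g x
    refine Prod.ext (S.comp_seq h₁ h₂ h₃ h₄ i j f.1 g.1 x.1) ?_
    simp only [dualComp, LinearMap.mk₂_apply, map_add, LinearMap.add_apply, signOp_comp]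
    rw [S.comp_seq h₁ h₂ h₃ h₄, S.comp_seq h₁ h₂ h₃ h₄, S.comp_seq h₁ h₂ h₃ h₄, add_assoc]
  comp_par := S.dualComp_par e
  comp_act := by
    intro m n p h j σ τ f g
    refine Prod.ext (S.comp_act h j σ τ f.1 g.1) ?_
    simp only [dualComp, LinearMap.mk₂_apply, MonoidHom.coe_mk, OneHom.coe_mk,
      LinearMap.prodMap_apply, map_add, SymSeq.signOp_act, S.comp_act]

end Operad

namespace FreeOperad

variable {k : Type u} [Field k] {E : Collection.{u, v} k}

theorem word_mem {n : ℕ} (t : Word E n) : word t ∈ (freeOperad E).deg n t.deg :=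
  mk_mem t

theorem closure_induction (K : ∀ n : ℕ, Submodule k ((freeOperad E).V n))
    (hι : ∀ n z, ι E n z ∈ K n)
    (hact : ∀ {n : ℕ} (σ : Perm (Fin n)) (x), x ∈ K n → (freeOperad E).act n σ x ∈ K n)
    (hcomp : ∀ {m n p : ℕ} (h : p + 1 = m + n) (i : Fin n) (s : ℤ) (f) (g),
      f ∈ (freeOperad E).deg m s → f ∈ K m → g ∈ K n → (freeOperad E).comp h i f g ∈ K p)
    {n : ℕ} (x : (freeOperad E).V n) : x ∈ K n := by
  refine word_induction (P := fun x => x ∈ K n) x (Submodule.zero_mem _)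
    (fun _ _ => Submodule.add_mem _) (fun c _ => Submodule.smul_mem _ c) fun t => ?_
  induction t with
  | gen j z => rw [← ι_of_mem]; exact hι _ _
  | act σ t ih => rw [← act_word]; exact hact σ _ (ih (word t))
  | comp h i s t hs ht =>
    rw [← comp_word]; exact hcomp h i _ _ _ (word_mem s) (hs (word s)) (ht (word t))

theorem ι_mem {n : ℕ} {j : ℤ} {z : E.V n} (hz : z ∈ E.deg n j) :
    ι E n z ∈ (freeOperad E).deg n j := by
  have := word_mem (Word.gen j (⟨z, hz⟩ : E.deg n j))
  rwa [Word.deg, ← ι_of_mem] at this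

theorem ι_act {n : ℕ} (σ : Perm (Fin n)) (z : E.V n) :
    ι E n (E.act n σ z) = (freeOperad E).act n σ (ι E n z) := by
  have : ι E n ∘ₗ E.act n σ = (freeOperad E).act n σ ∘ₗ ι E n := by
    refine E.hom_ext_of_deg fun j z hz => ?_
    simp only [LinearMap.comp_apply]
    rw [ι_of_mem E (⟨z, hz⟩ : E.deg n j), ι_of_mem E (⟨_, E.act_mem σ hz⟩ : E.deg n j), act_word]
    exact (mk_eq_of_rel_one _ _ (Word.Rel.gen_act j σ ⟨z, hz⟩)).symm
  exact LinearMap.congr_fun this z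

variable (E) in
/-- The inclusion of the generators. -/
noncomputable def ιHom : E.toSymSeq.Hom (freeOperad E).toSymSeq where
  map := ι E
  map_mem := ι_mem
  map_act := ι_act

section Lift

variable {T : Operad.{u, w} k}

/-- The homomorphism from the free operad extending a map of the generators. -/
noncomputable def lift (α : E.toSymSeq.Hom T.toSymSeq) : Operad.Hom (freeOperad E) T :=
  (existsUnique_hom E α.map (fun _ _ _ => α.map_mem) fun _ => α.map_act).choose

@[simp]
theorem lift_ι (α : E.toSymSeq.Hom T.toSymSeq) (n : ℕ) (z : E.V n) :
    (lift α).map n (ι E n z) = α.map n z :=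
  (existsUnique_hom E α.map (fun _ _ _ => α.map_mem) fun _ => α.map_act).choose_spec.1 n z

variable {φ ψ : Operad.Hom (freeOperad E) T}

/- An operation of arity `p ≤ N` is a composite of operations of arities at most `p`: the arity of
a factor exceeds that of the composite only if the other factor has arity `0`. -/
theorem hom_ext_of_arity_le {N : ℕ} (h : ∀ n ≤ N, ∀ z, φ.map n (ι E n z) = ψ.map n (ι E n z))
    {n : ℕ} (hn : n ≤ N) (x : (freeOperad E).V n) : φ.map n x = ψ.map n x := by
  suffices x ∈ ⨅ _ : n ≤ N, LinearMap.eqLocus (φ.map n) (ψ.map n) by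
    simpa only [hn, iInf_pos, LinearMap.mem_eqLocus] using this
  refine closure_induction (fun n => ⨅ _ : n ≤ N, LinearMap.eqLocus (φ.map n) (ψ.map n))
    ?_ ?_ ?_ x <;> simp only [Submodule.mem_iInf, LinearMap.mem_eqLocus]
  · exact fun n z hn => h n hn z
  · intro n σ x hx hn
    rw [φ.map_act, ψ.map_act, hx hn]
  · intro m n p hp i _ f g _ hf hg hpN
    rcases Nat.eq_zero_or_pos m with rfl | hm
    · have := (freeOperad E).subsingleton_zero
      simp [Subsingleton.elim f 0]
    · have hi := i.2
      rw [φ.map_comp, ψ.map_comp, hf (by omega), hg (by omega)]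

theorem hom_ext_ι (h : ∀ n z, φ.map n (ι E n z) = ψ.map n (ι E n z)) {n : ℕ}
    (x : (freeOperad E).V n) : φ.map n x = ψ.map n x :=
  hom_ext_of_arity_le (fun n _ => h n) le_rfl x

theorem eq_zero_of_lt_two {n : ℕ} (hn : n < 2) (x : (freeOperad E).V n) : x = 0 :=
  hom_ext_of_arity_le (φ := Operad.Hom.id _) (ψ := Operad.Hom.zero _ _) (N := 1)
    (fun n hn z => by
      have := E.subsingleton_of_lt_two n (by omega)
      rw [Subsingleton.elim z 0, map_zero, map_zero, map_zero])
    (by omega) x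

end Lift

section Derivation

variable {e : ℤ} (δ : E.toSymSeq.Hom ((freeOperad E).toSymSeq.shift e))

/-- The homomorphism to the square zero extension whose second component is the derivation
extending `δ`. -/
noncomputable def dualLift : Operad.Hom (freeOperad E) ((freeOperad E).dualNumbers e) :=
  lift (T := (freeOperad E).dualNumbers e) ((ιHom E).prod δ)

theorem dualLift_fst {n : ℕ} (x : (freeOperad E).V n) : ((dualLift δ).map n x).1 = x := by
  let fst : Operad.Hom ((freeOperad E).dualNumbers e) (freeOperad E) :=
    { map := fun n => LinearMap.fst k _ _
      map_mem := fun hx => hx.1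
      map_act := fun _ _ => rfl
      map_comp := fun _ _ _ _ => rfl }
  exact hom_ext_ι (φ := fst.comp (dualLift δ)) (ψ := Operad.Hom.id _)
    (fun n z => congrArg Prod.fst (lift_ι (T := (freeOperad E).dualNumbers e) _ n z)) x

/-- The derivation of the free operad extending a map `δ` of degree `e` on the generators. -/
noncomputable def derivation : Operad.Derivation (freeOperad E) e where
  map n := LinearMap.snd k _ _ ∘ₗ (dualLift δ).map n
  map_mem hx := ((dualLift δ).map_mem hx).2
  map_act σ x := congrArg Prod.snd ((dualLift δ).map_act σ x)
  leibniz := by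
    intro m n p h i s f g hf
    refine (congrArg Prod.snd ((dualLift δ).map_comp h i f g)).trans ?_
    change (freeOperad E).comp h i _ ((dualLift δ).map n g).1 +
      (freeOperad E).comp h i ((freeOperad E).signOp e m ((dualLift δ).map m f).1) _ = _
    rw [dualLift_fst, dualLift_fst, SymSeq.signOp_of_mem e hf, map_smul, LinearMap.smul_apply]
    rfl

@[simp]
theorem derivation_ι (n : ℕ) (z : E.V n) : (derivation δ).map n (ι E n z) = δ.map n z :=
  congrArg Prod.snd (lift_ι (T := (freeOperad E).dualNumbers e) _ n z)

theorem derivation_sq_eq_zero (D : Operad.Derivation (freeOperad E) (-1))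
    (hD : ∀ n z, D.map n (D.map n (ι E n z)) = 0) (n : ℕ) (x : (freeOperad E).V n) :
    D.map n (D.map n x) = 0 := by
  refine closure_induction (fun n => LinearMap.ker (D.map n ∘ₗ D.map n)) ?_ ?_ ?_ x <;>
    simp only [LinearMap.mem_ker, LinearMap.comp_apply]
  · exact hD
  · intro n σ x hx
    rw [D.map_act, D.map_act, hx, map_zero]
  · intro m n p h i s f g hs hf hg
    rw [D.leibniz h i g hs, map_add, map_smul, D.leibniz h i g (D.map_mem hs),
      D.leibniz h i _ hs, hf, hg, mul_add, koszulSign_add]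
    simp [koszulSign]

theorem hom_comm_derivation {T : Operad.{u, w} k} (φ : Operad.Hom (freeOperad E) T)
    (D : Operad.Derivation (freeOperad E) e) (D' : Operad.Derivation T e)
    (h : ∀ n z, φ.map n (D.map n (ι E n z)) = D'.map n (φ.map n (ι E n z)))
    {n : ℕ} (x : (freeOperad E).V n) : φ.map n (D.map n x) = D'.map n (φ.map n x) := by
  refine closure_induction (fun n => LinearMap.eqLocus (φ.map n ∘ₗ D.map n)
    (D'.map n ∘ₗ φ.map n)) ?_ ?_ ?_ x <;>
    simp only [LinearMap.mem_eqLocus, LinearMap.comp_apply]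
  · exact h
  · intro n σ x hx
    rw [D.map_act, φ.map_act, φ.map_act, D'.map_act, hx]
  · intro m n p h i s f g hs hf hg
    rw [D.leibniz h i g hs, map_add, map_smul, φ.map_comp, φ.map_comp, φ.map_comp,
      D'.leibniz h i _ (φ.map_mem hs), hf, hg]

end Derivation

section MapHom

variable {E' : Collection.{u, w} k} {E'' : Collection.{u, w₁} k}

/-- The homomorphism of free operads induced by a map of collections. -/
noncomputable def mapHom (φ : E.toSymSeq.Hom E'.toSymSeq) :
    Operad.Hom (freeOperad E) (freeOperad E') :=
  lift ((ιHom E').comp φ)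

@[simp]
theorem mapHom_ι (φ : E.toSymSeq.Hom E'.toSymSeq) (n : ℕ) (z : E.V n) :
    (mapHom φ).map n (ι E n z) = ι E' n (φ.map n z) :=
  lift_ι _ n z

theorem mapHom_mapHom {φ : E.toSymSeq.Hom E'.toSymSeq} {ψ : E'.toSymSeq.Hom E''.toSymSeq}
    {χ : E.toSymSeq.Hom E''.toSymSeq} (h : ∀ n z, ψ.map n (φ.map n z) = χ.map n z) {n : ℕ}
    (x : (freeOperad E).V n) : (mapHom ψ).map n ((mapHom φ).map n x) = (mapHom χ).map n x :=
  hom_ext_ι (φ := (mapHom ψ).comp (mapHom φ)) (ψ := mapHom χ)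
    (fun n z => by simp [Operad.Hom.comp, h]) x

end MapHom

end FreeOperad

/-- A map of decomposed collections: one taking each piece to the piece of the same index. -/
structure Collection.Decomposition.Map {k : Type u} [Field k] {E : Collection.{u, v} k}
    {E' : Collection.{u, w} k} (P : E.Decomposition) (P' : E'.Decomposition) extends
    E.toSymSeq.Hom E'.toSymSeq where
  map_piece : ∀ {l n : ℕ} {z : E.V n}, z ∈ P.piece l n → map n z ∈ P'.piece l n

namespace FreeOperad

variable {k : Type u} [Field k] {E : Collection.{u, v} k} {E' : Collection.{u, w} k}

section Bigrading

variable {P : E.Decomposition} {P' : E'.Decomposition}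

/-- The component of TJ-degree `l` and inner degree `j` of the free operad on a decomposed
collection. -/
noncomputable def tjDeg (P : E.Decomposition) (l : ℕ) (j : ℤ) (n : ℕ) :
    Submodule k ((freeOperad E).V n) :=
  Submodule.span k {x | ∃ t : Word E n, t.HasTJ P l ∧ t.deg = j ∧ word t = x}

theorem ι_mem_tjDeg {l : ℕ} {j : ℤ} {n : ℕ} {z : E.V n} (hl : z ∈ P.piece l n)
    (hj : z ∈ E.deg n j) : ι E n z ∈ tjDeg P l j n :=
  Submodule.subset_span ⟨Word.gen j ⟨z, hj⟩, Word.HasTJ.gen hl, by rw [Word.deg],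
    (ι_of_mem E (⟨z, hj⟩ : E.deg n j)).symm⟩

theorem act_mem_tjDeg {l : ℕ} {j : ℤ} {n : ℕ} (σ : Perm (Fin n)) {x : (freeOperad E).V n}
    (hx : x ∈ tjDeg P l j n) : (freeOperad E).act n σ x ∈ tjDeg P l j n := by
  have : tjDeg P l j n ≤ (tjDeg P l j n).comap ((freeOperad E).act n σ) := by
    refine Submodule.span_le.2 ?_
    rintro _ ⟨t, ht, hd, rfl⟩
    exact Submodule.subset_span ⟨Word.act σ t, ht.act σ, hd, (act_word σ t).symm⟩
  exact this hx

theorem comp_mem_tjDeg {l l' : ℕ} {j j' : ℤ} {m n p : ℕ} (h : p + 1 = m + n) (i : Fin n)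
    {f : (freeOperad E).V m} {g : (freeOperad E).V n} (hf : f ∈ tjDeg P l j m)
    (hg : g ∈ tjDeg P l' j' n) : (freeOperad E).comp h i f g ∈ tjDeg P (l + l') (j + j') p := by
  have := Submodule.apply_mem_map₂ ((freeOperad E).comp h i) hf hg
  rw [tjDeg, tjDeg, Submodule.map₂_span_span] at this
  refine Submodule.span_mono ?_ this
  rintro _ ⟨_, ⟨s, hs, rfl, rfl⟩, _, ⟨t, ht, rfl, rfl⟩, rfl⟩
  exact ⟨Word.comp h i s t, hs.comp h i ht, by rw [Word.deg], (comp_word h i s t).symm⟩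

theorem tjDeg_le (K : ∀ n : ℕ, ℕ → ℤ → Submodule k ((freeOperad E).V n))
    (hι : ∀ {n l j z}, z ∈ P.piece l n → z ∈ E.deg n j → ι E n z ∈ K n l j)
    (hact : ∀ {n l j} (σ : Perm (Fin n)) {x}, x ∈ K n l j → (freeOperad E).act n σ x ∈ K n l j)
    (hcomp : ∀ {m n p : ℕ} (h : p + 1 = m + n) (i : Fin n) {l l' j j' f g},
      f ∈ tjDeg P l j m → g ∈ tjDeg P l' j' n → f ∈ K m l j → g ∈ K n l' j' →
      (freeOperad E).comp h i f g ∈ K p (l + l') (j + j')) (l : ℕ) (j : ℤ) (n : ℕ) :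
    tjDeg P l j n ≤ K n l j := by
  refine Submodule.span_le.2 ?_
  rintro _ ⟨t, ht, rfl, rfl⟩
  induction ht with
  | @gen n l j z hz =>
    rw [← ι_of_mem, Word.deg]
    exact hι hz z.2
  | act σ _ ih =>
    rw [← act_word, Word.deg]
    exact hact σ ih
  | comp h i hs ht ihs iht =>
    rw [← comp_word, Word.deg]
    exact hcomp h i (Submodule.subset_span ⟨_, hs, rfl, rfl⟩)
      (Submodule.subset_span ⟨_, ht, rfl, rfl⟩) ihs iht

theorem tjDeg_le_deg (l : ℕ) (j : ℤ) (n : ℕ) : tjDeg P l j n ≤ (freeOperad E).deg n j := by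
  refine Submodule.span_le.2 ?_
  rintro _ ⟨t, -, rfl, rfl⟩
  exact word_mem t

theorem tjDeg_le_tjPiece (l : ℕ) (j : ℤ) (n : ℕ) : tjDeg P l j n ≤ tjPiece P l n :=
  Submodule.span_mono fun _ ⟨t, ht, _, h⟩ => ⟨t, ht, h⟩

theorem proj_mem_tjDeg {l : ℕ} (j : ℤ) {n : ℕ} {x : (freeOperad E).V n}
    (hx : x ∈ tjPiece P l n) : (freeOperad E).proj n j x ∈ tjDeg P l j n := by
  have : tjPiece P l n ≤ (tjDeg P l j n).comap ((freeOperad E).proj n j) := by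
    refine Submodule.span_le.2 ?_
    rintro _ ⟨t, ht, rfl⟩
    change (freeOperad E).proj n j (word t) ∈ tjDeg P l j n
    rw [SymSeq.proj_of_mem _ j (word_mem t)]
    split_ifs with h
    · exact Submodule.subset_span ⟨t, ht, h, rfl⟩
    · exact Submodule.zero_mem _
  exact this hx

variable (P) in
theorem iSup_tjDeg (n : ℕ) : ⨆ i : ℕ × ℤ, tjDeg P i.1 i.2 n = ⊤ := by
  refine eq_top_iff.2 fun x _ => closure_induction (fun n => ⨆ i : ℕ × ℤ, tjDeg P i.1 i.2 n)
    (fun n z => ?_) (fun {n} σ x hx => ?_) (fun {m n p} h i _ f g _ hf hg => ?_) x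
  · have : ⨆ l, P.piece l n ≤ (⨆ i : ℕ × ℤ, tjDeg P i.1 i.2 n).comap (ι E n) := by
      refine iSup_le fun l => (P.le_iSup_inf_deg l n).trans (iSup_le fun j z hz => ?_)
      exact Submodule.mem_iSup_of_mem (l, j) (ι_mem_tjDeg hz.1 hz.2)
    rw [(P.isInternal n).submodule_iSup_eq_top] at this
    exact this Submodule.mem_top
  · have : ⨆ i : ℕ × ℤ, tjDeg P i.1 i.2 n ≤
        (⨆ i : ℕ × ℤ, tjDeg P i.1 i.2 n).comap ((freeOperad E).act n σ) :=
      iSup_le fun i x hx => Submodule.mem_iSup_of_mem i (act_mem_tjDeg σ hx)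
    exact this hx
  · have := Submodule.apply_mem_map₂ ((freeOperad E).comp h i) hf hg
    rw [Submodule.map₂_iSup_left] at this
    simp only [Submodule.map₂_iSup_right] at this
    refine (iSup_le fun a => iSup_le fun b => Submodule.map₂_le.2 fun f hf g hg => ?_ :
      _ ≤ ⨆ i : ℕ × ℤ, tjDeg P i.1 i.2 p) this
    exact Submodule.mem_iSup_of_mem (a.1 + b.1, a.2 + b.2) (comp_mem_tjDeg h i hf hg)

theorem mapHom_mem_tjDeg (φ : P.Map P') {l : ℕ} {j : ℤ} {n : ℕ} {x : (freeOperad E).V n}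
    (hx : x ∈ tjDeg P l j n) : (mapHom φ.toHom).map n x ∈ tjDeg P' l j n := by
  refine tjDeg_le (P := P) (fun n l j => (tjDeg P' l j n).comap ((mapHom φ.toHom).map n))
    ?_ ?_ ?_ l j n hx
  · intro n l j z hl hj
    rw [Submodule.mem_comap, mapHom_ι]
    exact ι_mem_tjDeg (φ.map_piece hl) (φ.map_mem hj)
  · intro n l j σ x hx
    rw [Submodule.mem_comap, (mapHom φ.toHom).map_act]
    exact act_mem_tjDeg σ hx
  · intro m n p h i l l' j j' f g _ _ hf hg
    rw [Submodule.mem_comap, (mapHom φ.toHom).map_comp]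
    exact comp_mem_tjDeg h i hf hg

theorem mapHom_mem_tjPiece (φ : P.Map P') {l n : ℕ} {x : (freeOperad E).V n}
    (hx : x ∈ tjPiece P l n) : (mapHom φ.toHom).map n x ∈ tjPiece P' l n :=
  SymSeq.mem_of_proj_mem _ ((tjPiece P' l n).comap ((mapHom φ.toHom).map n)) x fun j =>
    tjDeg_le_tjPiece l j n (mapHom_mem_tjDeg φ (proj_mem_tjDeg j hx))

theorem derivation_eq_zero_of_mem_tjDeg_zero {e : ℤ} (D : Operad.Derivation (freeOperad E) e)
    (hD : ∀ n, ∀ z ∈ P.piece 0 n, D.map n (ι E n z) = 0) {j : ℤ} {n : ℕ}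
    {x : (freeOperad E).V n} (hx : x ∈ tjDeg P 0 j n) : D.map n x = 0 := by
  suffices x ∈ ⨅ _ : 0 = 0, LinearMap.ker (D.map n) by simpa using this
  refine tjDeg_le (P := P) (fun n l _ => ⨅ _ : l = 0, LinearMap.ker (D.map n)) ?_ ?_ ?_ 0 j n hx
    <;> simp only [Submodule.mem_iInf, LinearMap.mem_ker]
  · rintro n l j z hl _ rfl
    exact hD n z hl
  · intro n l _ σ x hx hl
    rw [D.map_act, hx hl, map_zero]
  · intro m n p h i l l' j j' f g hf' _ hf hg hl
    rw [D.leibniz h i g (tjDeg_le_deg l j m hf'), hf (by omega), hg (by omega)]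
    simp

theorem hom_eq_zero_of_mem_tjDeg_succ {T : Operad.{u, w} k} (ρ : Operad.Hom (freeOperad E) T)
    (hρ : ∀ l n, ∀ z ∈ P.piece (l + 1) n, ρ.map n (ι E n z) = 0) {l : ℕ} {j : ℤ} {n : ℕ}
    {x : (freeOperad E).V n} (hx : x ∈ tjDeg P (l + 1) j n) : ρ.map n x = 0 := by
  suffices x ∈ ⨅ _ : l + 1 ≠ 0, LinearMap.ker (ρ.map n) by simpa using this
  refine tjDeg_le (P := P) (fun n l _ => ⨅ _ : l ≠ 0, LinearMap.ker (ρ.map n))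
    ?_ ?_ ?_ (l + 1) j n hx <;> simp only [Submodule.mem_iInf, LinearMap.mem_ker]
  · intro n l j z hl _ h0
    obtain ⟨l, rfl⟩ := Nat.exists_eq_succ_of_ne_zero h0
    exact hρ l n z hl
  · intro n l _ σ x hx hl
    rw [ρ.map_act, hx hl, map_zero]
  · intro m n p h i l l' j j' f g _ _ hf hg hl
    rw [ρ.map_comp]
    by_cases h0 : l = 0
    · rw [hg (by omega), map_zero]
    · rw [hf h0, map_zero, LinearMap.zero_apply]

theorem mapHom_mapHom_of_arity_lt {φ : E.toSymSeq.Hom E'.toSymSeq}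
    {ψ : E'.toSymSeq.Hom E.toSymSeq} {m : ℕ} (h : ∀ n < m, ∀ z, φ.map n (ψ.map n z) = z) {n : ℕ}
    (hn : n < m) (x : (freeOperad E').V n) : (mapHom φ).map n ((mapHom ψ).map n x) = x :=
  hom_ext_of_arity_le (φ := (mapHom φ).comp (mapHom ψ)) (ψ := Operad.Hom.id _) (N := n)
    (fun i hi z => by
      simp only [Operad.Hom.comp, Operad.Hom.id, LinearMap.comp_apply, mapHom_ι,
        h i (by omega) z, LinearMap.id_apply])
    le_rfl x

/- The factors of an operation that is not a generator have smaller arities, where `ψ` is a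
section of `φ`. -/
theorem tjDeg_le_ι_sup_mapHom (φ : P.Map P') (ψ : P'.Map P) {m : ℕ}
    (hφψ : ∀ n < m, ∀ z, φ.map n (ψ.map n z) = z) (l : ℕ) (j : ℤ) :
    tjDeg P' l j m ≤ (P'.piece l m ⊓ E'.deg m j).map (ι E' m) ⊔
      (tjDeg P l j m).map ((mapHom φ.toHom).map m) := by
  intro x hx
  suffices x ∈ ⨅ _ : m = m, (P'.piece l m ⊓ E'.deg m j).map (ι E' m) ⊔
      (tjDeg P l j m).map ((mapHom φ.toHom).map m) from Submodule.mem_iInf _ |>.1 this rfl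
  refine tjDeg_le (P := P') (fun n l j => ⨅ _ : n = m, (P'.piece l n ⊓ E'.deg n j).map (ι E' n) ⊔
    (tjDeg P l j n).map ((mapHom φ.toHom).map n)) ?_ ?_ ?_ l j m hx <;>
    simp only [Submodule.mem_iInf]
  · exact fun hl hj _ => Submodule.mem_sup_left ⟨_, ⟨hl, hj⟩, rfl⟩
  · intro n l j σ x hx hn
    obtain ⟨_, ⟨z, hz, rfl⟩, _, ⟨y, hy, rfl⟩, rfl⟩ := Submodule.mem_sup.1 (hx hn)
    rw [map_add, ← ι_act, ← (mapHom φ.toHom).map_act]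
    exact Submodule.add_mem _
      (Submodule.mem_sup_left ⟨_, ⟨P'.act_mem σ hz.1, E'.act_mem σ hz.2⟩, rfl⟩)
      (Submodule.mem_sup_right ⟨_, act_mem_tjDeg σ hy, rfl⟩)
  · intro a n p h i l l' j j' f g hf hg _ _ hp
    have := i.2
    by_cases ha : a < 2
    · rw [eq_zero_of_lt_two ha f, map_zero, LinearMap.zero_apply]
      exact Submodule.zero_mem _
    by_cases hn : n < 2
    · rw [eq_zero_of_lt_two hn g, map_zero]
      exact Submodule.zero_mem _
    rw [← mapHom_mapHom_of_arity_lt hφψ (by omega) f, ← mapHom_mapHom_of_arity_lt hφψ (by omega) g,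
      ← (mapHom φ.toHom).map_comp]
    exact Submodule.mem_sup_right ⟨_,
      comp_mem_tjDeg h i (mapHom_mem_tjDeg ψ hf) (mapHom_mem_tjDeg ψ hg), rfl⟩

end Bigrading

theorem one_le_length {n : ℕ} (t : Word E n) : 1 ≤ t.length := by
  induction t with
  | gen j z => rw [Word.length]
  | act σ t ih => rwa [Word.length]
  | comp h i s t hs ht => rw [Word.length]; omega

theorem act_mem_lengthGE {r n : ℕ} (σ : Perm (Fin n)) {x : (freeOperad E).V n}
    (hx : x ∈ lengthGE E r n) : (freeOperad E).act n σ x ∈ lengthGE E r n := by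
  have : lengthGE E r n ≤ (lengthGE E r n).comap ((freeOperad E).act n σ) := by
    refine Submodule.span_le.2 ?_
    rintro _ ⟨t, ht, rfl⟩
    exact Submodule.subset_span ⟨Word.act σ t, ht, (act_word σ t).symm⟩
  exact this hx

variable (E) in
theorem lengthGE_one (n : ℕ) : lengthGE E 1 n = ⊤ :=
  eq_top_iff.2 fun x _ => word_induction (P := fun x => x ∈ lengthGE E 1 n) x
    (Submodule.zero_mem _) (fun _ _ => Submodule.add_mem _) (fun _ _ => Submodule.smul_mem _ _)
    fun t => Submodule.subset_span ⟨t, one_le_length t, rfl⟩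

theorem comp_mem_lengthGE {r s m n p : ℕ} (h : p + 1 = m + n) (i : Fin n)
    {f : (freeOperad E).V m} {g : (freeOperad E).V n} (hf : f ∈ lengthGE E r m)
    (hg : g ∈ lengthGE E s n) : (freeOperad E).comp h i f g ∈ lengthGE E (r + s) p := by
  have := Submodule.apply_mem_map₂ ((freeOperad E).comp h i) hf hg
  rw [lengthGE, lengthGE, Submodule.map₂_span_span] at this
  refine Submodule.span_mono ?_ this
  rintro _ ⟨_, ⟨a, ha, rfl⟩, _, ⟨b, hb, rfl⟩, rfl⟩
  exact ⟨Word.comp h i a b, by rw [Word.length]; omega, (comp_word h i a b).symm⟩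

theorem comp_mem_lengthGE_two {m n p : ℕ} (h : p + 1 = m + n) (i : Fin n)
    (f : (freeOperad E).V m) (g : (freeOperad E).V n) :
    (freeOperad E).comp h i f g ∈ lengthGE E 2 p :=
  comp_mem_lengthGE (r := 1) (s := 1) h i (lengthGE_one E m ▸ Submodule.mem_top)
    (lengthGE_one E n ▸ Submodule.mem_top)

theorem hom_mem_lengthGE_two (φ : Operad.Hom (freeOperad E) (freeOperad E')) {n : ℕ}
    (hn : Subsingleton (E.V n)) (x : (freeOperad E).V n) : φ.map n x ∈ lengthGE E' 2 n := by
  suffices x ∈ ⨅ _ : Subsingleton (E.V n), (lengthGE E' 2 n).comap (φ.map n) from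
    Submodule.mem_iInf _ |>.1 this hn
  refine closure_induction
    (fun n => ⨅ _ : Subsingleton (E.V n), (lengthGE E' 2 n).comap (φ.map n)) ?_ ?_ ?_ x <;>
    simp only [Submodule.mem_iInf, Submodule.mem_comap]
  · intro n z hn
    rw [hn.elim z 0, map_zero, map_zero]
    exact Submodule.zero_mem _
  · intro n σ x hx hn
    rw [φ.map_act]
    exact act_mem_lengthGE σ (hx hn)
  · intro m n p h i s f g _ _ _ _
    rw [φ.map_comp]
    exact comp_mem_lengthGE_two h i _ _

end FreeOperad

theorem exists_invariant_compl {k : Type u} [Field k] {G : Type w} [Monoid G] {M : Type v}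
    [AddCommGroup M] [Module k M] (ρ : Representation k G M) [ρ.IsSemisimpleRepresentation]
    {A B : Submodule k M} (hA : ∀ g, ∀ x ∈ A, ρ g x ∈ A) (hB : ∀ g, ∀ x ∈ B, ρ g x ∈ B) :
    ∃ C ≤ B, (∀ g, ∀ x ∈ C, ρ g x ∈ C) ∧ Disjoint A C ∧ B ≤ A ⊔ C := by
  obtain ⟨C, hC⟩ := exists_isCompl
    (⟨A ⊓ B, fun g x hx => ⟨hA g x hx.1, hB g x hx.2⟩⟩ : Subrepresentation ρ)
  have hdisj : A ⊓ B ⊓ C.toSubmodule = ⊥ := congrArg Subrepresentation.toSubmodule hC.inf_eq_bot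
  have hsup : A ⊓ B ⊔ C.toSubmodule = ⊤ := congrArg Subrepresentation.toSubmodule hC.sup_eq_top
  refine ⟨B ⊓ C.toSubmodule, inf_le_left, fun g x hx => ⟨hB g x hx.1,
    C.apply_mem_toSubmodule g hx.2⟩, disjoint_iff.2 ((inf_assoc ..).symm.trans hdisj), ?_⟩
  calc B = (A ⊓ B ⊔ C.toSubmodule) ⊓ B := by rw [hsup, top_inf_eq]
    _ = A ⊓ B ⊔ C.toSubmodule ⊓ B := sup_inf_assoc_of_le _ inf_le_right
    _ ≤ A ⊔ B ⊓ C.toSubmodule := sup_le_sup inf_le_left (inf_comm ..).le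

theorem isInternal_bot (k : Type u) [Field k] (I : Type*) [DecidableEq I] (M : Type v)
    [AddCommGroup M] [Module k M] [Subsingleton M] :
    DirectSum.IsInternal fun _ : I => (⊥ : Submodule k M) :=
  DirectSum.isInternal_submodule_of_iSupIndep_of_iSup_eq_top
    (fun _ => disjoint_bot_left) (Subsingleton.elim _ _)

section Fiber

variable {k : Type u} [Field k] {I κ : Type*} {M : I → Type v}
  [∀ i, AddCommGroup (M i)] [∀ i, Module k (M i)] {f : I → κ} {a : κ}

variable (k M f a) in
/-- The elements of a direct sum supported on a fibre of a map on the index set. -/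
def fiberSubmodule : Submodule k (Π₀ i, M i) :=
  ⨅ (i : I) (_ : f i ≠ a), LinearMap.ker (DFinsupp.lapply i)

theorem mem_fiberSubmodule {x : Π₀ i, M i} :
    x ∈ fiberSubmodule k M f a ↔ ∀ i, f i ≠ a → x i = 0 := by
  simp [fiberSubmodule]

theorem mapRange_mem_fiberSubmodule (A : ∀ i, M i →ₗ[k] M i) {x : Π₀ i, M i}
    (hx : x ∈ fiberSubmodule k M f a) :
    DFinsupp.mapRange.linearMap A x ∈ fiberSubmodule k M f a :=
  mem_fiberSubmodule.2 fun i hi => by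
    rw [DFinsupp.mapRange.linearMap_apply, DFinsupp.mapRange_apply, mem_fiberSubmodule.1 hx i hi,
      map_zero]

theorem single_mem_fiberSubmodule [DecidableEq I] (i : I) (y : M i) :
    DFinsupp.single i y ∈ fiberSubmodule k M f (f i) :=
  mem_fiberSubmodule.2 fun _ hi' => DFinsupp.single_eq_of_ne fun h => hi' (congrArg f h)

theorem sum_single_mem [DecidableEq I] {S : Submodule k (Π₀ i, M i)} {x : Π₀ i, M i}
    (h : ∀ i, x i ≠ 0 → DFinsupp.single i (x i) ∈ S) : x ∈ S := by
  classical
  rw [← DFinsupp.sum_single (f := x)]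
  exact Submodule.sum_mem _ fun i hi => h i (DFinsupp.mem_support_iff.1 hi)

theorem isInternal_fiberSubmodule [DecidableEq κ] :
    DirectSum.IsInternal (fiberSubmodule k M f) := by
  classical
  apply DirectSum.isInternal_submodule_of_iSupIndep_of_iSup_eq_top
  · intro a
    rw [Submodule.disjoint_def]
    intro x hx hx'
    ext i
    by_cases hi : f i = a
    · have : ⨆ b, ⨆ (_ : b ≠ a), fiberSubmodule k M f b ≤ LinearMap.ker (DFinsupp.lapply i) :=
        iSup₂_le fun b hb y hy => mem_fiberSubmodule.1 hy i (hi.trans_ne hb.symm)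
      exact this hx'
    · exact mem_fiberSubmodule.1 hx i hi
  · exact eq_top_iff.2 fun x _ => sum_single_mem fun i _ =>
      Submodule.mem_iSup_of_mem (f i) (single_mem_fiberSubmodule i _)

theorem fiberSubmodule_le_iSup_inf {μ : Type*} (g : I → μ) :
    fiberSubmodule k M f a ≤ ⨆ b, fiberSubmodule k M f a ⊓ fiberSubmodule k M g b := by
  classical
  refine fun x hx => sum_single_mem fun i hi => ?_
  have hfi : f i = a := not_imp_comm.1 (mem_fiberSubmodule.1 hx i) hi
  exact Submodule.mem_iSup_of_mem (g i)
    ⟨hfi ▸ single_mem_fiberSubmodule i _, single_mem_fiberSubmodule i _⟩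

theorem lsum_mem_of_mem_fiberSubmodule [DecidableEq I] {N : Type w} [AddCommGroup N] [Module k N]
    {S : Submodule k N} {L : ∀ i, M i →ₗ[k] N} (h : ∀ i, f i = a → ∀ y, L i y ∈ S)
    {x : Π₀ i, M i} (hx : x ∈ fiberSubmodule k M f a) : DFinsupp.lsum ℕ L x ∈ S := by
  rw [DFinsupp.lsum_apply_apply]
  exact dfinsuppSumAddHom_mem S x _ fun i hi =>
    h i (not_imp_comm.1 (mem_fiberSubmodule.1 hx i) hi) _

end Fiber

namespace Collection

variable {k : Type u} [Field k]

variable (k) in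
/-- The zero collection. -/
def empty : Collection.{u, v} k where
  V _ := PUnit
  act _ := 1
  deg _ _ := ⊥
  isInternal _ := isInternal_bot k ℤ PUnit
  act_mem _ _ _ _ := Subsingleton.elim (α := PUnit) _ _
  subsingleton_of_lt_two _ _ := inferInstanceAs (Subsingleton PUnit)

variable (k) in
/-- The decomposition of the zero collection. -/
def emptyDecomposition : (empty.{u, v} k).Decomposition where
  piece _ _ := ⊥
  isInternal _ := isInternal_bot k ℕ PUnit
  act_mem _ _ _ := Subsingleton.elim (α := PUnit) _ _
  le_iSup_inf_deg _ _ := bot_le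

variable {E : Collection.{u, v} k} {E' : Collection.{u, w} k} {E'' : Collection.{u, w₁} k}

/-- The direct sum of two collections. -/
abbrev prod (E : Collection.{u, v} k) (E' : Collection.{u, w} k) :
    Collection.{u, max v w} k where
  toSymSeq := E.toSymSeq.prod E'.toSymSeq
  subsingleton_of_lt_two n hn := by
    have := E.subsingleton_of_lt_two n hn
    have := E'.subsingleton_of_lt_two n hn
    infer_instance

/-- The diagonal of a sequence of collections: its operations of arity `n` are those of the
`n`-th collection. -/
def diagonal (A : ℕ → Collection.{u, v} k) : Collection.{u, v} k where
  V n := (A n).V n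
  act n := (A n).act n
  deg n := (A n).deg n
  isInternal n := (A n).isInternal n
  act_mem {n} := (A n).act_mem
  subsingleton_of_lt_two n := (A n).subsingleton_of_lt_two n

/-- The homomorphism from a diagonal given by a homomorphism from each of the collections. -/
def diagonalDesc {A : ℕ → Collection.{u, v} k} {T : SymSeq.{u, w} k}
    (φ : ∀ n, (A n).toSymSeq.Hom T) : (diagonal A).toSymSeq.Hom T where
  map n := (φ n).map n
  map_mem {n _ _} := (φ n).map_mem
  map_act {n} := (φ n).map_act

namespace Decomposition

/-- The decomposition of a direct sum of decomposed collections. -/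
def prod (P : E.Decomposition) (P' : E'.Decomposition) : (E.prod E').Decomposition where
  piece l n := (P.piece l n).prod (P'.piece l n)
  isInternal n := isInternal_prod (P.isInternal n) (P'.isInternal n)
  act_mem σ _ hx := ⟨P.act_mem σ hx.1, P'.act_mem σ hx.2⟩
  le_iSup_inf_deg l n := by
    rintro ⟨x, y⟩ ⟨hx, hy⟩
    have hx' : P.piece l n ≤ (⨆ j, (P.piece l n).prod (P'.piece l n) ⊓
        (E.deg n j).prod (E'.deg n j)).comap (LinearMap.inl k (E.V n) (E'.V n)) :=
      (P.le_iSup_inf_deg l n).trans <| iSup_le fun j z hz => Submodule.mem_iSup_of_mem j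
        ⟨⟨hz.1, Submodule.zero_mem _⟩, hz.2, Submodule.zero_mem _⟩
    have hy' : P'.piece l n ≤ (⨆ j, (P.piece l n).prod (P'.piece l n) ⊓
        (E.deg n j).prod (E'.deg n j)).comap (LinearMap.inr k (E.V n) (E'.V n)) :=
      (P'.le_iSup_inf_deg l n).trans <| iSup_le fun j z hz => Submodule.mem_iSup_of_mem j
        ⟨⟨Submodule.zero_mem _, hz.1⟩, Submodule.zero_mem _, hz.2⟩
    have := Submodule.add_mem _ (Submodule.mem_comap.1 (hx' hx)) (Submodule.mem_comap.1 (hy' hy))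
    rwa [LinearMap.inl_apply, LinearMap.inr_apply, Prod.mk_add_mk, add_zero, zero_add] at this

/-- The decomposition of a diagonal. -/
def diagonal {A : ℕ → Collection.{u, v} k} (P : ∀ n, (A n).Decomposition) :
    (Collection.diagonal A).Decomposition where
  piece l n := (P n).piece l n
  isInternal n := (P n).isInternal n
  act_mem {_ n} := (P n).act_mem
  le_iSup_inf_deg l n := (P n).le_iSup_inf_deg l n

namespace Map

variable {P : E.Decomposition} {P' : E'.Decomposition} {P'' : E''.Decomposition}

/-- The zero map. -/
def zero (P : E.Decomposition) (P' : E'.Decomposition) : P.Map P' where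
  __ := SymSeq.Hom.zero E.toSymSeq E'.toSymSeq
  map_piece _ := Submodule.zero_mem _

/-- The identity map. -/
def id (P : E.Decomposition) : P.Map P where
  map _ := LinearMap.id
  map_mem hx := hx
  map_act _ _ := rfl
  map_piece hx := hx

/-- The map from a direct sum with given components. -/
def coprod (φ : P.Map P'') (ψ : P'.Map P'') : (P.prod P').Map P'' where
  __ := φ.toHom.coprod ψ.toHom
  map_piece hx := Submodule.add_mem _ (φ.map_piece hx.1) (ψ.map_piece hx.2)

/-- The map to a direct sum with given components. -/
def prodMk (φ : P.Map P') (ψ : P.Map P'') : P.Map (P'.prod P'') where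
  __ := φ.toHom.prod ψ.toHom
  map_piece hx := ⟨φ.map_piece hx, ψ.map_piece hx⟩

/-- The inclusion of the first summand. -/
def inl (P : E.Decomposition) (P' : E'.Decomposition) : P.Map (P.prod P') :=
  (id P).prodMk (zero P P')

section Diagonal

variable {A : ℕ → Collection.{u, v} k} (P : ∀ n, (A n).Decomposition) (m : ℕ)

/-- The map to the diagonal which is the identity in arity `m` and zero in the other arities. -/
def toDiagonal : (P m).Map (diagonal P) where
  map n := if h : m = n then h ▸ LinearMap.id else 0
  map_mem {n j x} hx := by
    split_ifs with h
    · subst h; exact hx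
    · exact Submodule.zero_mem _
  map_act {n} σ x := by
    split_ifs with h
    · subst h; rfl
    · exact (map_zero ((A n).act n σ)).symm
  map_piece {l n x} hx := by
    split_ifs with h
    · subst h; exact hx
    · exact Submodule.zero_mem _

/-- The map from the diagonal which is the identity in arity `m` and zero in the other arities. -/
def ofDiagonal : (diagonal P).Map (P m) where
  map n := if h : n = m then h ▸ LinearMap.id else 0
  map_mem {n j x} hx := by
    split_ifs with h
    · subst h; exact hx
    · exact Submodule.zero_mem _
  map_act {n} σ x := by
    split_ifs with h
    · subst h; rfl
    · exact (map_zero ((A m).act n σ)).symm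
  map_piece {l n x} hx := by
    split_ifs with h
    · subst h; exact hx
    · exact Submodule.zero_mem _

theorem toDiagonal_self (x : (A m).V m) : (toDiagonal P m).map m x = x :=
  LinearMap.congr_fun (dif_pos rfl) x

theorem ofDiagonal_self (x : (A m).V m) : (ofDiagonal P m).map m x = x :=
  LinearMap.congr_fun (dif_pos rfl) x

theorem ofDiagonal_toDiagonal (x : (A m).V m) :
    (ofDiagonal P m).map m ((toDiagonal P m).map m x) = x := by
  rw [toDiagonal_self, ofDiagonal_self]

theorem toDiagonal_ofDiagonal (x : (Collection.diagonal A).V m) :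
    (toDiagonal P m).map m ((ofDiagonal P m).map m x) = x :=
  (congrArg ((toDiagonal P m).map m) (ofDiagonal_self P m x)).trans (toDiagonal_self P m x)

theorem diagonalDesc_toDiagonal {T : SymSeq.{u, w} k} (φ : ∀ n, (A n).toSymSeq.Hom T) {n : ℕ}
    (hn : n ≠ m → Subsingleton ((A m).V n)) (x : (A m).V n) :
    (diagonalDesc φ).map n ((toDiagonal P m).map n x) = (φ m).map n x := by
  by_cases h : n = m
  · subst h
    exact congrArg ((φ n).map n) (toDiagonal_self P n x)
  · have := hn h
    rw [Subsingleton.elim x 0, map_zero, map_zero, map_zero]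

end Diagonal

end Map

end Decomposition

end Collection

/-- A family of subrepresentations `piece l j n` of a sequence of graded representations, of
TJ-degree `l`, degree `j` and arity `n`. They need not be independent: the collection is
generated by their external direct sum. -/
structure SymSeq.BigradedFamily {k : Type u} [Field k] (S : SymSeq.{u, v} k) where
  piece : ℕ → ℤ → ∀ n, Submodule k (S.V n)
  le_deg : ∀ l j n, piece l j n ≤ S.deg n j
  act_mem : ∀ {l : ℕ} {j : ℤ} {n : ℕ} (σ : Perm (Fin n)) {x : S.V n},
    x ∈ piece l j n → S.act n σ x ∈ piece l j n
  eq_bot_of_lt_two : ∀ l j, ∀ n < 2, piece l j n = ⊥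

namespace SymSeq.BigradedFamily

variable {k : Type u} [Field k] {S : SymSeq.{u, v} k} (A : S.BigradedFamily)

/-- The action of a permutation on the external direct sum. -/
def act {n : ℕ} (σ : Perm (Fin n)) : (Π₀ i : ℕ × ℤ, A.piece i.1 i.2 n) →ₗ[k]
    Π₀ i : ℕ × ℤ, A.piece i.1 i.2 n :=
  DFinsupp.mapRange.linearMap fun _ => (S.act n σ).restrict fun _ => A.act_mem σ

theorem subsingleton_of_eq_bot {n : ℕ} (h : ∀ l j, A.piece l j n = ⊥) :
    Subsingleton (Π₀ i : ℕ × ℤ, A.piece i.1 i.2 n) := by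
  have : ∀ i : ℕ × ℤ, Subsingleton (A.piece i.1 i.2 n) := fun i => by
    rw [h]
    infer_instance
  infer_instance

/-- The external direct sum, as a collection. -/
def collection : Collection.{u, v} k where
  V n := Π₀ i : ℕ × ℤ, A.piece i.1 i.2 n
  act n :=
    { toFun := A.act
      map_one' := LinearMap.ext fun x => DFinsupp.ext fun i => Subtype.ext <| by simp [act]
      map_mul' := fun σ τ => LinearMap.ext fun x => DFinsupp.ext fun i => Subtype.ext <| by
        simp [act] }
  deg n j := fiberSubmodule k (fun i : ℕ × ℤ => A.piece i.1 i.2 n) Prod.snd j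
  isInternal n := isInternal_fiberSubmodule
  act_mem _ _ _ := mapRange_mem_fiberSubmodule _
  subsingleton_of_lt_two n hn := A.subsingleton_of_eq_bot fun l j => A.eq_bot_of_lt_two l j n hn

/-- The decomposition by the TJ-degree. -/
def decomposition : A.collection.Decomposition where
  piece l n := fiberSubmodule k (fun i : ℕ × ℤ => A.piece i.1 i.2 n) Prod.fst l
  isInternal _ := isInternal_fiberSubmodule
  act_mem _ _ := mapRange_mem_fiberSubmodule _
  le_iSup_inf_deg _ _ := fiberSubmodule_le_iSup_inf Prod.snd

/-- The natural map, which adds up the components. -/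
def val : A.collection.toSymSeq.Hom S where
  map _ := DFinsupp.lsum ℕ fun i => (A.piece i.1 i.2 _).subtype
  map_mem hx := lsum_mem_of_mem_fiberSubmodule (fun i hi y => hi ▸ A.le_deg i.1 i.2 _ y.2) hx
  map_act σ x := by
    refine LinearMap.congr_fun (f := DFinsupp.lsum ℕ (fun i => (A.piece i.1 i.2 _).subtype) ∘ₗ
      A.act σ) (g := S.act _ σ ∘ₗ _) (DFinsupp.lhom_ext fun i y => ?_) x
    simp [act]

variable {A} {l n : ℕ} {j : ℤ} {x : S.V n}

theorem val_mem {z : A.collection.V n} {K : Submodule k (S.V n)}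
    (hz : z ∈ A.decomposition.piece l n) (hK : ∀ j, A.piece l j n ≤ K) : A.val.map n z ∈ K :=
  lsum_mem_of_mem_fiberSubmodule (fun i hi y => hK i.2 (hi ▸ y.2)) hz

theorem val_mem_of_forall {K : Submodule k (S.V n)} (hK : ∀ l j, A.piece l j n ≤ K)
    (z : A.collection.V n) : A.val.map n z ∈ K := by
  have : ⨆ l, A.decomposition.piece l n ≤ K.comap (A.val.map n) :=
    iSup_le fun l _ hz => val_mem hz (hK l)
  rw [(A.decomposition.isInternal n).submodule_iSup_eq_top] at this
  exact this Submodule.mem_top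

theorem exists_val_eq (hx : x ∈ A.piece l j n) :
    ∃ z ∈ A.decomposition.piece l n, z ∈ A.collection.deg n j ∧ A.val.map n z = x :=
  ⟨DFinsupp.single (l, j) ⟨x, hx⟩, single_mem_fiberSubmodule (f := Prod.fst) (l, j) _,
    single_mem_fiberSubmodule (f := Prod.snd) (l, j) _,
    DFinsupp.lsum_single ..⟩

theorem exists_eq_single {z : A.collection.V n} (hl : z ∈ A.decomposition.piece l n)
    (hj : z ∈ A.collection.deg n j) :
    ∃ y : A.piece l j n, z = DFinsupp.single (l, j) y := by
  let z' : Π₀ i : ℕ × ℤ, A.piece i.1 i.2 n := z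
  refine ⟨z' (l, j), DFinsupp.ext (f := z') fun i => ?_⟩
  by_cases hi : i = (l, j)
  · subst hi
    rw [DFinsupp.single_eq_same]
  · rw [DFinsupp.single_eq_of_ne hi]
    by_cases hi₁ : i.1 = l
    · exact mem_fiberSubmodule.1 hj i fun hi₂ => hi (Prod.ext hi₁ hi₂)
    · exact mem_fiberSubmodule.1 hl i hi₁

theorem eq_zero_of_val_mem {z : A.collection.V n} (hl : z ∈ A.decomposition.piece l n)
    (hj : z ∈ A.collection.deg n j) {K : Submodule k (S.V n)} (hK : Disjoint K (A.piece l j n))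
    (hz : A.val.map n z ∈ K) : z = 0 := by
  obtain ⟨y, rfl⟩ := exists_eq_single hl hj
  have hy : A.val.map n (DFinsupp.single (l, j) y) = y := DFinsupp.lsum_single ..
  rw [hy] at hz
  have hy₀ : y = 0 := Subtype.ext (Submodule.disjoint_def.1 hK _ hz y.2)
  subst hy₀
  exact DFinsupp.single_zero (l, j)

end SymSeq.BigradedFamily

/-- Decomposed generators together with the values on them of a derivation `d` of degree `-1` of
the free operad and of a homomorphism `ρ` to `H`. That these form a bigraded model of `H` is the
condition `IsBigradedModel`. -/
structure QuasiFreeData {k : Type u} [Field k] (H : Operad.{u, v} k) where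
  Z : Collection.{u, max u v} k
  P : Z.Decomposition
  δ : Z.toSymSeq.Hom ((freeOperad Z).toSymSeq.shift (-1))
  r : Z.toSymSeq.Hom H.toSymSeq

namespace QuasiFreeData

open FreeOperad Collection Decomposition

variable {k : Type u} [Field k] {H : Operad.{u, v} k} (M : QuasiFreeData H)

/-- The free operad on the generators. -/
noncomputable abbrev F : Operad.{u, max u v} k := freeOperad M.Z

/-- The derivation with the given values on the generators. -/
noncomputable def d : Operad.Derivation M.F (-1) := derivation M.δ

/-- The homomorphism with the given values on the generators. -/
noncomputable def ρ : Operad.Hom M.F H := lift M.r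

@[simp]
theorem d_ι (n : ℕ) (z : M.Z.V n) : M.d.map n (ι M.Z n z) = M.δ.map n z := derivation_ι M.δ n z

@[simp]
theorem ρ_ι (n : ℕ) (z : M.Z.V n) : M.ρ.map n (ι M.Z n z) = M.r.map n z := lift_ι M.r n z

/-- Compatibility of a map of the generators with `d` and `ρ`. -/
structure IsHom {M N : QuasiFreeData H} (φ : M.P.Map N.P) : Prop where
  map_δ : ∀ n z, N.δ.map n (φ.map n z) = (mapHom φ.toHom).map n (M.δ.map n z)
  map_r : ∀ n z, N.r.map n (φ.map n z) = M.r.map n z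

namespace IsHom

variable {M} {N : QuasiFreeData H} {φ : M.P.Map N.P}

theorem map_d (hφ : IsHom φ) (n : ℕ) (x : M.F.V n) :
    (mapHom φ.toHom).map n (M.d.map n x) = N.d.map n ((mapHom φ.toHom).map n x) :=
  hom_comm_derivation (mapHom φ.toHom) M.d N.d (fun n z => by simp [hφ.map_δ]) x

theorem map_ρ (hφ : IsHom φ) (n : ℕ) (x : M.F.V n) :
    N.ρ.map n ((mapHom φ.toHom).map n x) = M.ρ.map n x :=
  hom_ext_ι (φ := N.ρ.comp (mapHom φ.toHom)) (ψ := M.ρ)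
    (fun n z => by simp [Operad.Hom.comp, hφ.map_r]) x

end IsHom

/-! ### Adding generators of one arity -/

/-- The sequence containing the values `(d z, ρ z)` of the generators `z`. -/
noncomputable abbrev target : SymSeq.{u, max u v} k := (M.F.toSymSeq.shift (-1)).prod H.toSymSeq

/-- The map `(d, ρ)`. -/
noncomputable def coneMap : M.F.toSymSeq.Hom M.target := M.d.toSymSeqHom.prod M.ρ.toSymSeqHom

/-- The admissible values `(d z, ρ z)` of a new generator `z` of TJ-degree `l` and degree `j`. -/
noncomputable def coneCycles : ℕ → ℤ → ∀ n, Submodule k (M.target.V n)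
  | 0, j, n => Submodule.prod ⊥ (H.deg n j)
  | l + 1, j, n =>
    (tjDeg M.P l (j + -1) n ⊓ LinearMap.ker (M.d.map n) ⊓ LinearMap.ker (M.ρ.map n)).prod ⊥

theorem coneCycles_le_deg (l : ℕ) (j : ℤ) (n : ℕ) : M.coneCycles l j n ≤ M.target.deg n j := by
  cases l
  · exact Submodule.prod_mono bot_le le_rfl
  · exact Submodule.prod_mono (inf_le_left.trans (inf_le_left.trans (tjDeg_le_deg ..))) bot_le

theorem act_mem_coneCycles {l : ℕ} {j : ℤ} {n : ℕ} (σ : Perm (Fin n)) {x : M.target.V n}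
    (hx : x ∈ M.coneCycles l j n) : M.target.act n σ x ∈ M.coneCycles l j n := by
  obtain ⟨u, h⟩ := x
  cases l
  · obtain ⟨hu : u = 0, hh⟩ := hx
    exact ⟨(congrArg (M.F.act n σ) hu).trans (map_zero _), H.act_mem σ hh⟩
  · obtain ⟨⟨⟨htj, hd : M.d.map n u = 0⟩, hρ : M.ρ.map n u = 0⟩, hh : h = 0⟩ := hx
    refine ⟨⟨⟨act_mem_tjDeg σ htj, ?_⟩, ?_⟩, (congrArg (H.act n σ) hh).trans (map_zero _)⟩
    · exact (M.d.map_act σ u).trans (by rw [hd, map_zero])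
    · exact (M.ρ.map_act σ u).trans (by rw [hρ, map_zero])

theorem exists_compl_range_coneMap [CharZero k] (l : ℕ) (j : ℤ) (n : ℕ) :
    ∃ C ≤ M.coneCycles l j n, (∀ σ, ∀ x ∈ C, M.target.act n σ x ∈ C) ∧
      Disjoint (LinearMap.range (M.coneMap.map n)) C ∧
      M.coneCycles l j n ≤ LinearMap.range (M.coneMap.map n) ⊔ C := by
  refine exists_invariant_compl (M.target.act n) ?_ fun σ x => M.act_mem_coneCycles σ
  rintro σ _ ⟨x, rfl⟩
  exact ⟨M.F.act n σ x, M.coneMap.map_act σ x⟩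

variable [CharZero k]

/-- An invariant complement, in the admissible values of new generators, of the values at elements
of the free operad. -/
noncomputable def newValues (l : ℕ) (j : ℤ) (n : ℕ) : Submodule k (M.target.V n) :=
  (M.exists_compl_range_coneMap l j n).choose

theorem newValues_le (l : ℕ) (j : ℤ) (n : ℕ) : M.newValues l j n ≤ M.coneCycles l j n :=
  (M.exists_compl_range_coneMap l j n).choose_spec.1

theorem act_mem_newValues {l : ℕ} {j : ℤ} {n : ℕ} (σ : Perm (Fin n)) {x : M.target.V n}
    (hx : x ∈ M.newValues l j n) : M.target.act n σ x ∈ M.newValues l j n :=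
  (M.exists_compl_range_coneMap l j n).choose_spec.2.1 σ x hx

theorem disjoint_range_newValues (l : ℕ) (j : ℤ) (n : ℕ) :
    Disjoint (LinearMap.range (M.coneMap.map n)) (M.newValues l j n) :=
  (M.exists_compl_range_coneMap l j n).choose_spec.2.2.1

theorem coneCycles_le_range_sup (l : ℕ) (j : ℤ) (n : ℕ) :
    M.coneCycles l j n ≤ LinearMap.range (M.coneMap.map n) ⊔ M.newValues l j n :=
  (M.exists_compl_range_coneMap l j n).choose_spec.2.2.2

/-- The values of the new generators of arity `a`. -/
noncomputable def newFamily (a : ℕ) : M.target.BigradedFamily where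
  piece l j n := if n = a ∧ 2 ≤ n then M.newValues l j n else ⊥
  le_deg l j n := by
    split_ifs
    · exact (M.newValues_le l j n).trans (M.coneCycles_le_deg l j n)
    · exact bot_le
  act_mem {l j n} σ x hx := by
    split_ifs at hx ⊢
    · exact M.act_mem_newValues σ hx
    · rw [(Submodule.mem_bot k).1 hx, map_zero]
      exact Submodule.zero_mem _
  eq_bot_of_lt_two _ _ n hn := if_neg fun h => h.2.not_gt hn

theorem newFamily_piece {n : ℕ} (hn : 2 ≤ n) (l : ℕ) (j : ℤ) :
    (M.newFamily n).piece l j n = M.newValues l j n :=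
  if_pos ⟨rfl, hn⟩

theorem newFamily_piece_le (a l : ℕ) (j : ℤ) (n : ℕ) :
    (M.newFamily a).piece l j n ≤ M.coneCycles l j n := by
  unfold newFamily
  dsimp only
  split_ifs
  · exact M.newValues_le l j n
  · exact bot_le

/-- The new generators of arity `a`. -/
noncomputable abbrev newColl (a : ℕ) : Collection.{u, max u v} k := (M.newFamily a).collection

/-- The decomposition of the new generators by the TJ-degree. -/
noncomputable abbrev newDecomposition (a : ℕ) : (M.newColl a).Decomposition :=
  (M.newFamily a).decomposition

theorem newColl_subsingleton {a n : ℕ} (h : n ≠ a) : Subsingleton ((M.newColl a).V n) :=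
  (M.newFamily a).subsingleton_of_eq_bot fun _ _ => if_neg fun h' => h h'.1

/-- The values of `d` on the new generators. -/
noncomputable def newδ (a : ℕ) : (M.newColl a).toSymSeq.Hom (M.F.toSymSeq.shift (-1)) :=
  (SymSeq.Hom.fst _ _).comp (M.newFamily a).val

/-- The values of `ρ` on the new generators. -/
noncomputable def newR (a : ℕ) : (M.newColl a).toSymSeq.Hom H.toSymSeq :=
  (SymSeq.Hom.snd _ _).comp (M.newFamily a).val

/-- The data with the new generators of arity `a` added. -/
noncomputable def next (a : ℕ) : QuasiFreeData H where
  Z := M.Z.prod (M.newColl a)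
  P := M.P.prod (M.newDecomposition a)
  δ := ((mapHom (Map.inl M.P (M.newDecomposition a)).toHom).toSymSeqHom.shift (-1)).comp
    (M.δ.coprod (M.newδ a))
  r := M.r.coprod (M.newR a)

/-! ### Values on the new generators -/

section NewGenerators

variable {M} {a l n : ℕ} {j : ℤ}

theorem newδ_eq_zero {z : (M.newColl a).V n} (hz : z ∈ (M.newDecomposition a).piece 0 n) :
    (M.newδ a).map n z = 0 :=
  (SymSeq.BigradedFamily.val_mem (A := M.newFamily a) (K := .prod ⊥ ⊤) hz fun j _ hx =>
    ⟨(M.newFamily_piece_le a 0 j n hx).1, Submodule.mem_top⟩).1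

theorem newδ_mem_tjPiece {z : (M.newColl a).V n}
    (hz : z ∈ (M.newDecomposition a).piece (l + 1) n) :
    (M.newδ a).map n z ∈ tjPiece M.P l n :=
  (SymSeq.BigradedFamily.val_mem (A := M.newFamily a) (K := .prod (tjPiece M.P l n) ⊤) hz
    fun j _ hx =>
    ⟨tjDeg_le_tjPiece l _ n (M.newFamily_piece_le a (l + 1) j n hx).1.1.1, Submodule.mem_top⟩).1

theorem newR_eq_zero {z : (M.newColl a).V n}
    (hz : z ∈ (M.newDecomposition a).piece (l + 1) n) : (M.newR a).map n z = 0 :=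
  (SymSeq.BigradedFamily.val_mem (A := M.newFamily a) (K := .prod ⊤ ⊥) hz fun j _ hx =>
    ⟨Submodule.mem_top, (M.newFamily_piece_le a (l + 1) j n hx).2⟩).2

theorem newδ_mem_ker (z : (M.newColl a).V n) :
    (M.newδ a).map n z ∈ LinearMap.ker (M.d.map n) ⊓ LinearMap.ker (M.ρ.map n) := by
  refine (SymSeq.BigradedFamily.val_mem_of_forall (A := M.newFamily a) (K := Submodule.prod
    (LinearMap.ker (M.d.map n) ⊓ LinearMap.ker (M.ρ.map n)) ⊤) (fun l j x hx => ?_) z).1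
  have hx' := M.newFamily_piece_le a l j n hx
  refine ⟨?_, Submodule.mem_top⟩
  cases l
  · rw [(Submodule.mem_bot k).1 hx'.1]
    exact Submodule.zero_mem _
  · exact ⟨hx'.1.1.2, hx'.1.2⟩

theorem eq_zero_of_newδ_add_d_eq_zero (hn : 2 ≤ n) {z : (M.newColl n).V n}
    (hl : z ∈ (M.newDecomposition n).piece l n) (hj : z ∈ (M.newColl n).deg n j)
    {w : M.F.V n} (hd : (M.newδ n).map n z + M.d.map n w = 0)
    (hρ : (M.newR n).map n z + M.ρ.map n w = 0) : z = 0 := by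
  have hmem : (M.newFamily n).val.map n z ∈ LinearMap.range (M.coneMap.map n) := by
    refine ⟨-w, Prod.ext ?_ ?_⟩
    · exact (map_neg (M.d.map n) w).trans (neg_eq_of_add_eq_zero_left hd)
    · exact (map_neg (M.ρ.map n) w).trans (neg_eq_of_add_eq_zero_left hρ)
  exact SymSeq.BigradedFamily.eq_zero_of_val_mem hl hj
    (M.newFamily_piece hn l j ▸ M.disjoint_range_newValues l j n) hmem

theorem exists_coneMap_add_val_eq (hn : 2 ≤ n) {x : M.target.V n} (hx : x ∈ M.coneCycles l j n) :
    ∃ (y : M.F.V n) (z : (M.newColl n).V n),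
      M.d.map n y + (M.newδ n).map n z = x.1 ∧ M.ρ.map n y + (M.newR n).map n z = x.2 := by
  obtain ⟨_, ⟨y, rfl⟩, c, hc, rfl⟩ := Submodule.mem_sup.1 (M.coneCycles_le_range_sup l j n hx)
  obtain ⟨z, -, -, rfl⟩ :=
    SymSeq.BigradedFamily.exists_val_eq (A := M.newFamily n) (M.newFamily_piece hn l j ▸ hc)
  exact ⟨y, z, rfl, rfl⟩

theorem exists_d_add_newδ_eq (hn : 2 ≤ n) {x : M.F.V n} (hx : x ∈ tjDeg M.P l j n)
    (hd : M.d.map n x = 0) (hρ : M.ρ.map n x = 0) :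
    ∃ (y : M.F.V n) (z : (M.newColl n).V n), M.d.map n y + (M.newδ n).map n z = x := by
  have hmem : (x, (0 : H.V n)) ∈ M.coneCycles (l + 1) (j + 1) n := by
    refine ⟨⟨⟨?_, hd⟩, hρ⟩, Submodule.zero_mem _⟩
    rwa [add_neg_cancel_right]
  obtain ⟨y, z, h, -⟩ := exists_coneMap_add_val_eq hn hmem
  exact ⟨y, z, h⟩

theorem exists_ρ_add_newR_eq (hn : 2 ≤ n) {h : H.V n} (hh : h ∈ H.deg n j) :
    ∃ (y : M.F.V n) (z : (M.newColl n).V n), M.ρ.map n y + (M.newR n).map n z = h := by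
  have hmem : ((0 : M.F.V n), h) ∈ M.coneCycles 0 j n := ⟨Submodule.zero_mem _, hh⟩
  obtain ⟨y, z, -, hyz⟩ := exists_coneMap_add_val_eq hn hmem
  exact ⟨y, z, hyz⟩

end NewGenerators

end QuasiFreeData

namespace QuasiFreeData

open FreeOperad Collection Decomposition

variable {k : Type u} [Field k] [CharZero k]

/-! ### The union of the stages -/

/-- The data with no generators. -/
noncomputable def empty (H : Operad.{u, v} k) : QuasiFreeData H where
  Z := Collection.empty k
  P := emptyDecomposition k
  δ := SymSeq.Hom.zero _ _
  r := SymSeq.Hom.zero _ _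

/-- The data obtained by adding generators of the arities `0`, …, `n - 1` in turn. -/
noncomputable def stage (H : Operad.{u, v} k) : ℕ → QuasiFreeData H
  | 0 => empty H
  | n + 1 => (stage H n).next n

theorem stage_subsingleton (H : Operad.{u, v} k) {n m : ℕ} (h : n ≤ m) :
    Subsingleton ((stage H n).Z.V m) := by
  induction n with
  | zero => exact inferInstanceAs (Subsingleton PUnit)
  | succ n ih =>
    have := ih (by omega)
    have := (stage H n).newColl_subsingleton (show m ≠ n by omega)
    exact inferInstanceAs (Subsingleton ((stage H n).Z.V m × ((stage H n).newColl n).V m))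

variable (H : Operad.{u, v} k)

/-- The generators of the union of the stages: those of arity `n` are the ones added to
stage `n`. -/
noncomputable abbrev limitColl : Collection.{u, max u v} k :=
  Collection.diagonal fun n => (stage H n).newColl n

/-- The decomposition of the generators of the union by the TJ-degree. -/
noncomputable abbrev limitDecomposition : (limitColl H).Decomposition :=
  Decomposition.diagonal fun n => (stage H n).newDecomposition n

/-- The inclusion of the generators added to stage `n`. -/
noncomputable def newToLimit (n : ℕ) :
    ((stage H n).newDecomposition n).Map (limitDecomposition H) :=
  Map.toDiagonal (fun n => (stage H n).newDecomposition n) n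

/-- The projection to the generators added to stage `n`. -/
noncomputable def limitToNew (n : ℕ) :
    (limitDecomposition H).Map ((stage H n).newDecomposition n) :=
  Map.ofDiagonal (fun n => (stage H n).newDecomposition n) n

theorem limitToNew_newToLimit (n : ℕ) (z : ((stage H n).newColl n).V n) :
    (limitToNew H n).map n ((newToLimit H n).map n z) = z :=
  Map.ofDiagonal_toDiagonal (fun n => (stage H n).newDecomposition n) n z

theorem newToLimit_limitToNew (n : ℕ) (z : (limitColl H).V n) :
    (newToLimit H n).map n ((limitToNew H n).map n z) = z :=
  Map.toDiagonal_ofDiagonal (fun n => (stage H n).newDecomposition n) n z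

/-- The inclusion of the generators of a stage. -/
noncomputable def toLimit : ∀ n, (stage H n).P.Map (limitDecomposition H)
  | 0 => Map.zero _ _
  | n + 1 => (toLimit n).coprod (newToLimit H n)

/-- The projection to the generators of a stage. -/
noncomputable def ofLimit : ∀ n, (limitDecomposition H).Map (stage H n).P
  | 0 => Map.zero _ _
  | n + 1 => (ofLimit n).prodMk (limitToNew H n)

theorem toLimit_succ (n m : ℕ) (x : (stage H n).Z.V m) (y : ((stage H n).newColl n).V m) :
    (toLimit H (n + 1)).map m (x, y) = (toLimit H n).map m x + (newToLimit H n).map m y :=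
  rfl

theorem ofLimit_succ (n m : ℕ) (x : (limitColl H).V m) :
    (ofLimit H (n + 1)).map m x = ((ofLimit H n).map m x, (limitToNew H n).map m x) :=
  rfl

theorem ofLimit_toLimit (n m : ℕ) (x : (stage H n).Z.V m) :
    (ofLimit H n).map m ((toLimit H n).map m x) = x := by
  induction n with
  | zero => exact Subsingleton.elim (α := PUnit) _ _
  | succ n ih =>
    obtain ⟨x, y⟩ := x
    rw [toLimit_succ, ofLimit_succ, map_add, map_add]
    by_cases h : m = n
    · subst h
      have := stage_subsingleton H (le_refl m)
      rw [Subsingleton.elim x 0, map_zero, map_zero, map_zero, zero_add, zero_add]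
      exact Prod.ext (Subsingleton.elim _ _) (limitToNew_newToLimit H m y)
    · have := (stage H n).newColl_subsingleton h
      rw [Subsingleton.elim y 0, map_zero, map_zero, add_zero, ih]
      exact Prod.ext rfl (Subsingleton.elim _ _)

variable {H} in
theorem toLimit_ofLimit {n m : ℕ} (h : m < n) (x : (limitColl H).V m) :
    (toLimit H n).map m ((ofLimit H n).map m x) = x := by
  induction n with
  | zero => omega
  | succ n ih =>
    rw [ofLimit_succ, toLimit_succ]
    by_cases hm : m = n
    · subst hm
      have := stage_subsingleton H (le_refl m)
      rw [Subsingleton.elim ((ofLimit H m).map m x) 0, map_zero, zero_add]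
      exact newToLimit_limitToNew H m x
    · have := (stage H n).newColl_subsingleton hm
      rw [ih (by omega), Subsingleton.elim ((limitToNew H n).map m x) 0, map_zero, add_zero]

theorem mapHom_toLimit_injective (n m : ℕ) :
    Function.Injective ((mapHom (toLimit H n).toHom).map m) :=
  Function.LeftInverse.injective (g := (mapHom (ofLimit H n).toHom).map m) fun x =>
    mapHom_mapHom_of_arity_lt (fun i _ => ofLimit_toLimit H n i) m.lt_succ_self x

theorem mapHom_toLimit_succ_inl (n m : ℕ) (x : (stage H n).F.V m) :
    (mapHom (toLimit H (n + 1)).toHom).map m ((mapHom (Map.inl (stage H n).P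
      ((stage H n).newDecomposition n)).toHom).map m x) =
      (mapHom (toLimit H n).toHom).map m x := by
  refine mapHom_mapHom (fun m z => ?_) x
  exact (toLimit_succ H n m z 0).trans (by rw [map_zero, add_zero])

/-- The values of `d` on the generators of the union. -/
noncomputable def limitδ :
    (limitColl H).toSymSeq.Hom ((freeOperad (limitColl H)).toSymSeq.shift (-1)) :=
  diagonalDesc fun n =>
    ((mapHom (toLimit H n).toHom).toSymSeqHom.shift (-1)).comp ((stage H n).newδ n)

/-- The values of `ρ` on the generators of the union. -/
noncomputable def limitR : (limitColl H).toSymSeq.Hom H.toSymSeq :=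
  diagonalDesc fun n => (stage H n).newR n

theorem limitδ_newToLimit (n m : ℕ) (z : ((stage H n).newColl n).V m) :
    (limitδ H).map m ((newToLimit H n).map m z) =
      (mapHom (toLimit H n).toHom).map m (((stage H n).newδ n).map m z) :=
  Map.diagonalDesc_toDiagonal (fun n => (stage H n).newDecomposition n) n _
    (stage H n).newColl_subsingleton z

theorem limitR_newToLimit (n m : ℕ) (z : ((stage H n).newColl n).V m) :
    (limitR H).map m ((newToLimit H n).map m z) = ((stage H n).newR n).map m z :=
  Map.diagonalDesc_toDiagonal (fun n => (stage H n).newDecomposition n) n _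
    (stage H n).newColl_subsingleton z

theorem limitδ_toLimit (n m : ℕ) (z : (stage H n).Z.V m) :
    (limitδ H).map m ((toLimit H n).map m z) =
      (mapHom (toLimit H n).toHom).map m ((stage H n).δ.map m z) := by
  induction n with
  | zero =>
    have := stage_subsingleton H (Nat.zero_le m)
    rw [Subsingleton.elim z 0, map_zero, map_zero, map_zero, map_zero]
  | succ n ih =>
    obtain ⟨x, y⟩ := z
    rw [toLimit_succ, map_add, limitδ_newToLimit, ih, ← map_add]
    exact (mapHom_toLimit_succ_inl H n m _).symm

theorem limitR_toLimit (n m : ℕ) (z : (stage H n).Z.V m) :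
    (limitR H).map m ((toLimit H n).map m z) = (stage H n).r.map m z := by
  induction n with
  | zero =>
    have := stage_subsingleton H (Nat.zero_le m)
    rw [Subsingleton.elim z 0, map_zero, map_zero, map_zero]
  | succ n ih =>
    obtain ⟨x, y⟩ := z
    rw [toLimit_succ, map_add, limitR_newToLimit, ih]
    rfl

/-- The union of the stages. -/
noncomputable def limit : QuasiFreeData H where
  Z := limitColl H
  P := limitDecomposition H
  δ := limitδ H
  r := limitR H

theorem toLimit_isHom (n : ℕ) : IsHom (M := stage H n) (N := limit H) (toLimit H n) where
  map_δ := limitδ_toLimit H n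
  map_r := limitR_toLimit H n

theorem limit_d_mapHom_add {n : ℕ} (y : (stage H n).F.V n) (z : ((stage H n).newColl n).V n) :
    (limit H).d.map n ((mapHom (toLimit H n).toHom).map n y +
      ι (limitColl H) n ((newToLimit H n).map n z)) =
      (mapHom (toLimit H n).toHom).map n
        ((stage H n).d.map n y + ((stage H n).newδ n).map n z) := by
  refine (map_add ((limit H).d.map n) _ _).trans (Eq.trans ?_ (map_add _ _ _).symm)
  exact congrArg₂ _ ((toLimit_isHom H n).map_d n y).symm
    ((d_ι (limit H) n _).trans (limitδ_newToLimit H n n z))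

theorem limit_ρ_mapHom_add {n : ℕ} (y : (stage H n).F.V n) (z : ((stage H n).newColl n).V n) :
    (limit H).ρ.map n ((mapHom (toLimit H n).toHom).map n y +
      ι (limitColl H) n ((newToLimit H n).map n z)) =
      (stage H n).ρ.map n y + ((stage H n).newR n).map n z := by
  refine (map_add ((limit H).ρ.map n) _ _).trans ?_
  exact congrArg₂ _ ((toLimit_isHom H n).map_ρ n y)
    ((ρ_ι (limit H) n _).trans (limitR_newToLimit H n n z))

end QuasiFreeData

/-- The conditions under which quasi-free data define a minimal bigraded model of `H`, stated on
the generators and on the bihomogeneous elements. -/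
structure QuasiFreeData.IsBigradedModel {k : Type u} [Field k] {H : Operad.{u, v} k}
    (M : QuasiFreeData H) : Prop where
  d_δ : ∀ n z, M.d.map n (M.δ.map n z) = 0
  ρ_δ : ∀ n z, M.ρ.map n (M.δ.map n z) = 0
  δ_eq_zero : ∀ n, ∀ z ∈ M.P.piece 0 n, M.δ.map n z = 0
  δ_mem_tjPiece : ∀ l n, ∀ z ∈ M.P.piece (l + 1) n, M.δ.map n z ∈ FreeOperad.tjPiece M.P l n
  δ_mem_lengthGE : ∀ n z, M.δ.map n z ∈ FreeOperad.lengthGE M.Z 2 n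
  r_eq_zero : ∀ l n, ∀ z ∈ M.P.piece (l + 1) n, M.r.map n z = 0
  exists_d_eq : ∀ {l : ℕ} {j : ℤ} {n : ℕ} {x : M.F.V n}, x ∈ FreeOperad.tjDeg M.P l j n →
    M.d.map n x = 0 → M.ρ.map n x = 0 → ∃ y, M.d.map n y = x
  ρ_surjective : ∀ n, Function.Surjective (M.ρ.map n)

namespace QuasiFreeData

open FreeOperad Collection Decomposition

variable {k : Type u} [Field k] {H : Operad.{u, v} k}

section Limit

variable [CharZero k]

variable (H) in
theorem exists_mapHom_add_eq_of_mem_tjDeg {l n : ℕ} {j : ℤ} {x : (limit H).F.V n}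
    (hx : x ∈ tjDeg (limitDecomposition H) l j n) :
    ∃ w ∈ tjDeg (stage H n).P l j n, ∃ z ∈ ((stage H n).newDecomposition n).piece l n,
      z ∈ ((stage H n).newColl n).deg n j ∧
      (mapHom (toLimit H n).toHom).map n w +
        ι (limitColl H) n ((newToLimit H n).map n z) = x := by
  obtain ⟨_, ⟨z, ⟨hzl, hzj⟩, rfl⟩, _, ⟨w, hw, rfl⟩, rfl⟩ := Submodule.mem_sup.1
    (tjDeg_le_ι_sup_mapHom (toLimit H n) (ofLimit H n) (fun _ hm => toLimit_ofLimit hm) l j hx)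
  refine ⟨w, hw, (limitToNew H n).map n z, (limitToNew H n).map_piece hzl,
    (limitToNew H n).map_mem hzj, ?_⟩
  rw [newToLimit_limitToNew, add_comm]

theorem exists_d_limit_eq {l n : ℕ} {j : ℤ} {x : (limit H).F.V n}
    (hx : x ∈ tjDeg (limit H).P l j n) (hd : (limit H).d.map n x = 0)
    (hρ : (limit H).ρ.map n x = 0) : ∃ y, (limit H).d.map n y = x := by
  obtain hn | hn := lt_or_ge n 2
  · exact ⟨0, (map_zero _).trans (eq_zero_of_lt_two hn x).symm⟩
  obtain ⟨w, hw, z, hzl, hzj, rfl⟩ := exists_mapHom_add_eq_of_mem_tjDeg H hx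
  rw [limit_d_mapHom_add] at hd
  rw [limit_ρ_mapHom_add, add_comm] at hρ
  have hd' := mapHom_toLimit_injective H n n (hd.trans (map_zero _).symm)
  obtain rfl : z = 0 := eq_zero_of_newδ_add_d_eq_zero hn hzl hzj ((add_comm _ _).trans hd') hρ
  rw [map_zero, zero_add] at hρ
  rw [map_zero, add_zero] at hd'
  obtain ⟨y, z', rfl⟩ := exists_d_add_newδ_eq hn hw hd' hρ
  refine ⟨_, (limit_d_mapHom_add H y z').trans ?_⟩
  rw [map_zero, map_zero, add_zero]

theorem limit_ρ_surjective (hH : Subsingleton (H.V 1)) (n : ℕ) :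
    Function.Surjective ((limit H).ρ.map n) := by
  rw [← LinearMap.range_eq_top, eq_top_iff, ← H.iSup_deg n]
  refine iSup_le fun j h hh => ?_
  obtain hn | hn := lt_or_ge n 2
  · have : Subsingleton (H.V n) := by
      interval_cases n
      exacts [H.subsingleton_zero, hH]
    exact ⟨0, Subsingleton.elim _ _⟩
  obtain ⟨y, z, rfl⟩ := exists_ρ_add_newR_eq (M := stage H n) hn hh
  exact ⟨_, limit_ρ_mapHom_add H y z⟩

theorem limit_isBigradedModel (hH : Subsingleton (H.V 1)) : (limit H).IsBigradedModel where
  d_δ n z := by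
    refine ((toLimit_isHom H n).map_d n _).symm.trans ?_
    exact (congrArg _ (newδ_mem_ker z).1).trans (map_zero _)
  ρ_δ n z := ((toLimit_isHom H n).map_ρ n _).trans (newδ_mem_ker z).2
  δ_eq_zero n z hz :=
    (congrArg ((mapHom (toLimit H n).toHom).map n) (newδ_eq_zero hz)).trans (map_zero _)
  δ_mem_tjPiece l n z hz := mapHom_mem_tjPiece (toLimit H n) (newδ_mem_tjPiece hz)
  δ_mem_lengthGE n z := hom_mem_lengthGE_two (mapHom (toLimit H n).toHom)
    (stage_subsingleton H le_rfl) _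
  r_eq_zero l n z hz := newR_eq_zero hz
  exists_d_eq := exists_d_limit_eq
  ρ_surjective := limit_ρ_surjective hH

end Limit

/-! ### The homology of a bigraded model -/

namespace IsBigradedModel

variable {M : QuasiFreeData H} (hM : M.IsBigradedModel)

include hM

/-- The derivation `d`, as a differential. -/
noncomputable def differential : M.F.Differential where
  toDerivation := M.d
  map_map := derivation_sq_eq_zero M.d fun n z => by rw [d_ι, hM.d_δ]

theorem ρ_commutes : M.ρ.Commutes hM.differential H.zeroDifferential :=
  fun _ x => hom_comm_derivation M.ρ M.d H.zeroDifferential.toDerivation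
    (fun n z => by rw [d_ι]; exact hM.ρ_δ n z) x

theorem ρ_eq_zero {l n : ℕ} (hl : 1 ≤ l) {x : M.F.V n} (hx : x ∈ tjPiece M.P l n) :
    M.ρ.map n x = 0 := by
  obtain ⟨l, rfl⟩ := Nat.exists_eq_add_of_le' hl
  refine SymSeq.mem_of_proj_mem _ (LinearMap.ker (M.ρ.map n)) x fun j => ?_
  exact hom_eq_zero_of_mem_tjDeg_succ M.ρ (fun l n z hz => by rw [ρ_ι, hM.r_eq_zero l n z hz])
    (proj_mem_tjDeg j hx)

theorem d_eq_zero {n : ℕ} {x : M.F.V n} (hx : x ∈ tjPiece M.P 0 n) : M.d.map n x = 0 := by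
  refine SymSeq.mem_of_proj_mem _ (LinearMap.ker (M.d.map n)) x fun j => ?_
  exact derivation_eq_zero_of_mem_tjDeg_zero M.d (fun n z hz => by rw [d_ι, hM.δ_eq_zero n z hz])
    (proj_mem_tjDeg j hx)

theorem exists_d_eq_of_mem_tjPiece {l n : ℕ} {x : M.F.V n} (hx : x ∈ tjPiece M.P l n)
    (hd : M.d.map n x = 0) (hρ : M.ρ.map n x = 0) : ∃ y, M.d.map n y = x := by
  refine SymSeq.mem_of_proj_mem _ (LinearMap.range (M.d.map n)) x fun j => ?_
  refine hM.exists_d_eq (proj_mem_tjDeg j hx) (hM.differential.proj_mem_cycles j hd) ?_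
  exact (M.ρ.toSymSeqHom.map_proj n j x).trans (by rw [← map_zero (H.proj n j), ← hρ]; rfl)

theorem exists_mem_tjPiece_zero_ρ_eq {n : ℕ} (h : H.V n) :
    ∃ x ∈ tjPiece M.P 0 n, M.ρ.map n x = h := by
  obtain ⟨x, rfl⟩ := hM.ρ_surjective n h
  have : ⨆ i : ℕ × ℤ, tjDeg M.P i.1 i.2 n ≤
      ((tjPiece M.P 0 n).map (M.ρ.map n)).comap (M.ρ.map n) := by
    refine iSup_le fun i x hx => ?_
    obtain ⟨_ | l, j⟩ := i
    · exact ⟨x, tjDeg_le_tjPiece _ _ _ hx, rfl⟩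
    · rw [Submodule.mem_comap, hM.ρ_eq_zero (Nat.le_add_left 1 l) (tjDeg_le_tjPiece _ _ _ hx)]
      exact Submodule.zero_mem _
  rw [iSup_tjDeg] at this
  exact this Submodule.mem_top

theorem homologyPiece_eq_bot {l : ℕ} (hl : 1 ≤ l) (n : ℕ) :
    hM.differential.homologyPiece (tjPiece M.P l n) = ⊥ := by
  rw [eq_bot_iff]
  rintro _ ⟨x, hx, rfl⟩
  exact (Submodule.mem_bot k).2 (hM.differential.cls_eq_zero.2
    (hM.exists_d_eq_of_mem_tjPiece hx x.2 (hM.ρ_eq_zero hl hx)))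

theorem homologyDesc_bijective (n : ℕ) : Function.Bijective
    (((M.ρ.homologyDesc hM.differential hM.ρ_commutes).map n).domRestrict
      (hM.differential.homologyPiece (tjPiece M.P 0 n))) := by
  refine ⟨?_, fun h => ?_⟩
  · rintro ⟨_, x, hx, rfl⟩ ⟨_, y, hy, rfl⟩ hxy
    have hρ : M.ρ.map n (x - y).1 = 0 := (map_sub (M.ρ.map n) x.1 y.1).trans (sub_eq_zero.2 hxy)
    have hcls : hM.differential.cls n (x - y) = 0 := hM.differential.cls_eq_zero.2
      (hM.exists_d_eq_of_mem_tjPiece (Submodule.sub_mem _ hx hy) (x - y).2 hρ)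
    exact Subtype.ext (sub_eq_zero.1 ((map_sub _ x y).symm.trans hcls))
  · obtain ⟨x, hx, rfl⟩ := hM.exists_mem_tjPiece_zero_ρ_eq h
    exact ⟨⟨_, ⟨x, hM.d_eq_zero hx⟩, hx, rfl⟩, rfl⟩

end IsBigradedModel

end QuasiFreeData

theorem mainTheorem4 {k : Type u} [Field k] [CharZero k] (H : Operad.{u, v} k)
    (hH : Subsingleton (H.V 1)) :
    ∃ (Z : Collection.{u, max u v} k) (P : Z.Decomposition)
      (d : (freeOperad Z).Differential) (ρ : Operad.Hom (freeOperad Z) H)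
      (hρ : ρ.Commutes d H.zeroDifferential),
      -- the differential lowers the TJ-degree by one
      (∀ n, ∀ z ∈ P.piece 0 n, d.map n (FreeOperad.ι Z n z) = 0) ∧
      (∀ l n, ∀ z ∈ P.piece (l + 1) n,
        d.map n (FreeOperad.ι Z n z) ∈ FreeOperad.tjPiece P l n) ∧
      -- the differential is minimal
      (∀ n, ∀ z : Z.V n, d.map n (FreeOperad.ι Z n z) ∈ FreeOperad.lengthGE Z 2 n) ∧
      -- `ρ` vanishes on the generators of positive TJ-degree
      (∀ l ≥ 1, ∀ n, ∀ z ∈ P.piece l n, ρ.map n (FreeOperad.ι Z n z) = 0) ∧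
      -- `ρ` induces an isomorphism from the homology in TJ-degree zero
      (∀ n, Function.Bijective
        (((ρ.homologyDesc d hρ).map n).domRestrict
          (d.homologyPiece (FreeOperad.tjPiece P 0 n)))) ∧
      -- the homology in positive TJ-degrees vanishes
      (∀ l ≥ 1, ∀ n, d.homologyPiece (FreeOperad.tjPiece P l n) = ⊥) := by
  have hM := QuasiFreeData.limit_isBigradedModel hH
  set M := QuasiFreeData.limit H
  have hd (n : ℕ) (z : M.Z.V n) :
      hM.differential.map n (FreeOperad.ι M.Z n z) = M.δ.map n z := M.d_ι n z
  refine ⟨M.Z, M.P, hM.differential, M.ρ, hM.ρ_commutes, fun n z hz => ?_, fun l n z hz => ?_,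
    fun n z => ?_, fun l hl n z hz => ?_, hM.homologyDesc_bijective,
    fun l hl n => hM.homologyPiece_eq_bot hl n⟩
  · rw [hd, hM.δ_eq_zero n z hz]
  · rw [hd]
    exact hM.δ_mem_tjPiece l n z hz
  · rw [hd]
    exact hM.δ_mem_lengthGE n z
  · obtain ⟨l, rfl⟩ := Nat.exists_eq_add_of_le' hl
    rw [M.ρ_ι, hM.r_eq_zero l n z hz]
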